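/- Let $X$ be a locally compact metrisable space and let $\phi : X \to X$ be a continuous, proper surjection. Write $\alpha_n(f) = f\circ\phi^n$ for $f \in C_0(X)$ (complex-valued functions) and $n \in \mathbb{Z}_+ = \{0,1,2,\dots\}$. Let $C_0(X)$ act faithfully (by an injective $*$-homomorphism into the bounded operators) on a Hilbert space $H_o$. On $H_o \otimes \ell^2(\mathbb{Z}_+)$ let $$\pi(U^n f)(\xi \otimes e_k) = \alpha_k(f)\xi \otimes e_{k+n} \qquad (n,k \ge 0,\ f \in C_0(X),\ \xi \in H_o).$$ The analytic crossed product $\mathcal{A} = C_0(X)\times_\phi \mathbb{Z}_+$ is the operator-norm closure of $$\Bigl\{\sum_{n\ge 0}\pi(U^n f_n) : f_n \in C_0(X),\ \sum_{n \ge 0}\|f_n\| < \infty\Bigr\},$$ and for $n \ge 0$ the $n$-th Fourier coefficient map $E_n : \mathcal{A} \to C_0(X)$ is the continuous extension of the contraction $\sum_k \pi(U^k f_k) \mapsto f_n$. Let $$X_r = \{x \in X : \text{for every neighbourhood } V \text{ of } x \text{ there is } n \ge 1 \text{ with } \phi^n(x) \in V\}$$ be the set of recurrent points of $(X,\phi)$,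 and let $\mathrm{Rad}(\mathcal{A})$ be the Jacobson radical of $\mathcal{A}$, i.e. the intersection of the kernels of all algebraically irreducible representations of $\mathcal{A}$. **Theorem.** $$\mathrm{Rad}\bigl(C_0(X)\times_\phi\mathbb{Z}_+\bigr) = \bigl\{A \in C_0(X)\times_\phi\mathbb{Z}_+ : E_0(A) = 0 \text{ and } E_n(A)|_{X_r} = 0 \text{ for all } n \ge 1\bigr\}.$$ -/

import Mathlib

open scoped ZeroAtInfty

namespace AnalyticCrossedProduct

/-! ### The Jacobson radical of a (not necessarily unital) complex algebra -/

section Radical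

universe u v

/-- An algebraically irreducible representation of the complex algebra `A` on a complex vector
space `V`: it is not the zero representation, and it has no invariant subspaces besides
`0` and `V`. -/
def IsIrreducibleRep {A : Type u} [NonUnitalRing A] [Module ℂ A] {V : Type v} [AddCommGroup V]
    [Module ℂ V] (π : A →ₙₐ[ℂ] Module.End ℂ V) : Prop :=
  (∃ a : A, π a ≠ 0) ∧
    ∀ W : Submodule ℂ V, (∀ a : A, ∀ w ∈ W, π a w ∈ W) → W = ⊥ ∨ W = ⊤

/-- The Jacobson radical: the intersection of all primitive ideals, that is, of the kernels of all
algebraically irreducible representations of `A`. An irreducible representation is isomorphic to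
the one on a quotient of `A` by a left ideal, so it is enough to let `V` range over the universe
of `A`. -/
def jacobsonRadical (A : Type u) [NonUnitalRing A] [Module ℂ A] : Set A :=
  {a | ∀ (V : Type u) [AddCommGroup V] [Module ℂ V] (π : A →ₙₐ[ℂ] Module.End ℂ V),
    IsIrreducibleRep π → π a = 0}

end Radical

/-! ### The dynamical system -/

section Dynamics

variable {X : Type*} [TopologicalSpace X] {φ : X → X}

/-- The set of recurrent points of `(X, φ)`. -/
def recurrentPoints (φ : X → X) : Set X :=
  {x | ∀ V ∈ nhds x, ∃ n : ℕ, 1 ≤ n ∧ φ^[n] x ∈ V}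

theorem isProperMap_iterate (hφ : IsProperMap φ) (n : ℕ) : IsProperMap (φ^[n]) := by
  induction n with
  | zero => exact isProperMap_id
  | succ n ih => exact ih.comp hφ

/-- A proper map, as a map that is continuous and tends to infinity at infinity. -/
def properToCocompact (hφ : IsProperMap φ) : CocompactMap X X where
  toFun := φ
  continuous_toFun := hφ.continuous
  cocompact_tendsto' := by
    rw [Filter.hasBasis_cocompact.tendsto_right_iff]
    intro K hK
    exact (hφ.isCompact_preimage hK).compl_mem_cocompact

/-- The endomorphism `α_n (f) = f ∘ φ^n` of `C_0(X)`. -/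
noncomputable def alpha (hφ : IsProperMap φ) (n : ℕ) : C₀(X, ℂ) →ₙₐ[ℂ] C₀(X, ℂ) :=
  ZeroAtInftyContinuousMap.compNonUnitalAlgHom (properToCocompact (isProperMap_iterate hφ n))

@[simp]
theorem alpha_apply (hφ : IsProperMap φ) (n : ℕ) (f : C₀(X, ℂ)) (x : X) :
    alpha hφ n f x = f (φ^[n] x) := rfl

theorem alpha_alpha (hφ : IsProperMap φ) (m n : ℕ) (f : C₀(X, ℂ)) :
    alpha hφ m (alpha hφ n f) = alpha hφ (m + n) f := by
  ext x
  simp only [alpha_apply]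
  rw [add_comm, Function.iterate_add_apply]

theorem alpha_zero (hφ : IsProperMap φ) (f : C₀(X, ℂ)) : alpha hφ 0 f = f := rfl

theorem norm_alpha_le (hφ : IsProperMap φ) (n : ℕ) (f : C₀(X, ℂ)) : ‖alpha hφ n f‖ ≤ ‖f‖ := by
  rw [← ZeroAtInftyContinuousMap.norm_toBCF_eq_norm,
    BoundedContinuousFunction.norm_le (norm_nonneg _)]
  intro x
  rw [← ZeroAtInftyContinuousMap.norm_toBCF_eq_norm]
  exact f.toBCF.norm_coe_le_norm (φ^[n] x)

end Dynamics

/-! ### The Hilbert space `H ⊗ ℓ²(ℤ₊)` and the unilateral shift on it -/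

noncomputable section Hilbert

variable (H : Type*) [NormedAddCommGroup H] [InnerProductSpace ℂ H]

/-- The Hilbert space `H ⊗ ℓ²(ℤ₊)`, realised as `ℓ²(ℤ₊, H)`; the vector `ξ ⊗ e_k` is
`lp.single 2 k ξ`. -/
abbrev L2 : Type _ := lp (fun _ : ℕ => H) 2

variable {H}

/-- The shifted sequence `(0, ξ 0, ξ 1, …)`. -/
def shiftSeq (ξ : ℕ → H) : ℕ → H
  | 0 => 0
  | k + 1 => ξ k

/-- The unilateral shift `ξ ⊗ e_k ↦ ξ ⊗ e_{k+1}`. -/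
def shift : L2 H →ₗᵢ[ℂ] L2 H where
  toFun ξ := ⟨shiftSeq ξ, by
    refine memℓp_gen ((summable_nat_add_iff 1).1 ?_)
    exact (lp.memℓp ξ).summable (by norm_num)⟩
  map_add' ξ η := by
    ext k
    cases k with
    | zero => exact (add_zero (0 : H)).symm
    | succ k => rfl
  map_smul' c ξ := by
    ext k
    cases k with
    | zero => exact (smul_zero c).symm
    | succ k => rfl
  norm_map' ξ := by
    have h2 : 0 < (2 : ENNReal).toReal := by norm_num
    rw [lp.norm_eq_tsum_rpow h2, lp.norm_eq_tsum_rpow h2]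
    congr 1
    have hs : Summable fun k => ‖shiftSeq ξ k‖ ^ (2 : ENNReal).toReal :=
      (summable_nat_add_iff 1).1 ((lp.memℓp ξ).summable h2)
    have h := hs.tsum_eq_zero_add
    simpa [shiftSeq] using h

theorem shift_single (k : ℕ) (ξ : H) :
    shift (lp.single 2 k ξ : L2 H) = lp.single 2 (k + 1) ξ := by
  ext j
  cases j with
  | zero => simp [shift, shiftSeq, lp.single_apply]
  | succ j => simp [shift, shiftSeq, lp.single_apply, Pi.single_apply]

/-- The unilateral shift as a bounded operator. -/
def shiftCLM : L2 H →L[ℂ] L2 H := (shift (H := H)).toContinuousLinearMap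

theorem norm_shiftCLM_pow_le (n : ℕ) : ‖(shiftCLM (H := H)) ^ n‖ ≤ 1 := by
  have h1 : ‖shiftCLM (H := H)‖ ≤ 1 := LinearIsometry.norm_toContinuousLinearMap_le _
  induction n with
  | zero => exact ContinuousLinearMap.norm_id_le
  | succ n ih =>
    rw [pow_succ]
    refine (ContinuousLinearMap.opNorm_comp_le _ _).trans ?_
    exact mul_le_one₀ ih (norm_nonneg _) h1

theorem shiftCLM_pow_single (n k : ℕ) (ξ : H) :
    ((shiftCLM (H := H)) ^ n) (lp.single 2 k ξ) = lp.single 2 (k + n) ξ := by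
  induction n with
  | zero => rfl
  | succ n ih =>
    rw [pow_succ', mul_apply_eq_comp, ih]
    exact shift_single (k + n) ξ

/-- Two bounded operators on `H ⊗ ℓ²(ℤ₊)` that agree on all `ξ ⊗ e_k` are equal. -/
theorem clm_ext_single {S T : L2 H →L[ℂ] L2 H}
    (h : ∀ (k : ℕ) (ξ : H), S (lp.single 2 k ξ) = T (lp.single 2 k ξ)) : S = T := by
  ext1 v
  have hv := lp.hasSum_single (by norm_num) v
  have h1 := hv.mapL S
  have h2 := hv.mapL T
  simp only [h] at h1
  exact h1.unique h2

/-- The `(n, 0)` matrix entry of a bounded operator on `H ⊗ ℓ²(ℤ₊)`: the operator `B` on `H` with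
`⟨B x, y⟩ = ⟨T (x ⊗ e_0), y ⊗ e_n⟩`. -/
def entry (n : ℕ) : (L2 H →L[ℂ] L2 H) →L[ℂ] (H →L[ℂ] H) :=
  LinearMap.mkContinuous
    { toFun := fun T : L2 H →L[ℂ] L2 H => (lp.evalCLM ℂ (fun _ : ℕ => H) 2 n).comp
        (T.comp (lp.singleContinuousLinearMap ℂ (fun _ : ℕ => H) 2 0))
      map_add' := fun S T => by ext; simp
      map_smul' := fun c T => by ext; simp }
    1
    (fun T => by
      refine ContinuousLinearMap.opNorm_le_bound _ (by positivity) fun x => ?_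
      rw [one_mul]
      refine (lp.norm_apply_le_norm (by norm_num)
        (T (lp.single 2 0 x) : L2 H) n).trans ((T.le_opNorm _).trans ?_)
      rw [lp.norm_single (by norm_num)])

theorem entry_apply (n : ℕ) (T : L2 H →L[ℂ] L2 H) (x : H) :
    entry n T x = (T (lp.single 2 0 x) : L2 H) n := rfl

theorem norm_entry_le (n : ℕ) (T : L2 H →L[ℂ] L2 H) : ‖entry n T‖ ≤ ‖T‖ := by
  refine ContinuousLinearMap.opNorm_le_bound _ T.opNorm_nonneg fun x => ?_
  refine (lp.norm_apply_le_norm (by norm_num)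
    (T (lp.single 2 0 x) : L2 H) n).trans ((T.le_opNorm _).trans ?_)
  rw [lp.norm_single (by norm_num)]

end Hilbert

/-! ### The analytic crossed product -/

noncomputable section CrossedProduct

variable {X : Type*} [TopologicalSpace X] {φ : X → X} (hφ : IsProperMap φ)
  {H : Type*} [NormedAddCommGroup H] [InnerProductSpace ℂ H] [CompleteSpace H]
  (ρ : C₀(X, ℂ) →⋆ₙₐ[ℂ] (H →L[ℂ] H))

/-- The diagonal operator `ξ ⊗ e_k ↦ α_k(f) ξ ⊗ e_k`, where `C_0(X)` acts on `H` through `ρ`. -/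
def diag (f : C₀(X, ℂ)) : L2 H →L[ℂ] L2 H :=
  lp.mapCLM 2 (fun k : ℕ => ρ (alpha hφ k f)) (norm_nonneg f)
    (fun k => (NonUnitalStarAlgHom.norm_apply_le ρ _).trans (norm_alpha_le hφ k f))

theorem diag_single (f : C₀(X, ℂ)) (k : ℕ) (ξ : H) :
    diag hφ ρ f (lp.single 2 k ξ) = lp.single 2 k (ρ (alpha hφ k f) ξ) := by
  ext j
  rcases eq_or_ne j k with rfl | h
  · simp [diag]
  · simp [diag, lp.single_apply, h]

/-- The operator `π(U^n f)` on `H ⊗ ℓ²(ℤ₊)`. -/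
def monomial (n : ℕ) (f : C₀(X, ℂ)) : L2 H →L[ℂ] L2 H := shiftCLM ^ n * diag hφ ρ f

/-- `π(U^n f) (ξ ⊗ e_k) = α_k(f) ξ ⊗ e_{k+n}`. -/
theorem monomial_single (n : ℕ) (f : C₀(X, ℂ)) (k : ℕ) (ξ : H) :
    monomial hφ ρ n f (lp.single 2 k ξ) = lp.single 2 (k + n) (ρ (alpha hφ k f) ξ) := by
  rw [monomial, mul_apply_eq_comp, diag_single, shiftCLM_pow_single]

theorem norm_monomial_le (n : ℕ) (f : C₀(X, ℂ)) : ‖monomial hφ ρ n f‖ ≤ ‖f‖ := by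
  refine (norm_mul_le _ _).trans ((mul_le_of_le_one_left (norm_nonneg _)
    (norm_shiftCLM_pow_le n)).trans ?_)
  exact lp.norm_mapCLM_le _ _ _ _

theorem monomial_add (n : ℕ) (f g : C₀(X, ℂ)) :
    monomial hφ ρ n (f + g) = monomial hφ ρ n f + monomial hφ ρ n g := by
  refine clm_ext_single fun k ξ => ?_
  simp only [add_apply, monomial_single, map_add, lp.single_add]

theorem monomial_smul (n : ℕ) (c : ℂ) (f : C₀(X, ℂ)) :
    monomial hφ ρ n (c • f) = c • monomial hφ ρ n f := by
  refine clm_ext_single fun k ξ => ?_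
  simp only [smul_apply, monomial_single, map_smul, lp.single_smul]

/-- `U^n f U^m g = U^{n+m} (α_m(f) g)`. -/
theorem monomial_mul (n m : ℕ) (f g : C₀(X, ℂ)) :
    monomial hφ ρ n f * monomial hφ ρ m g = monomial hφ ρ (n + m) (alpha hφ m f * g) := by
  refine clm_ext_single fun k ξ => ?_
  rw [mul_apply_eq_comp, monomial_single, monomial_single, monomial_single, map_mul,
    map_mul, alpha_alpha, mul_apply_eq_comp]
  congr 1
  omega

theorem monomial_sum (n : ℕ) {ι : Type*} (s : Finset ι) (f : ι → C₀(X, ℂ)) :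
    monomial hφ ρ n (∑ i ∈ s, f i) = ∑ i ∈ s, monomial hφ ρ n (f i) :=
  map_sum (AddMonoidHom.mk' (monomial hφ ρ n) (monomial_add hφ ρ n)) f s

theorem summable_norm_monomial {f : ℕ → C₀(X, ℂ)} (hf : Summable fun n => ‖f n‖) :
    Summable fun n => ‖monomial hφ ρ n (f n)‖ :=
  hf.of_nonneg_of_le (fun _ => norm_nonneg _) fun n => norm_monomial_le hφ ρ n (f n)

/-- The image of `ℓ¹(ℤ₊, C_0(X))` under the representation `π`: the operators
`π(∑ U^n f_n) = ∑ π(U^n f_n)` with `∑ ‖f_n‖ < ∞`. -/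
def l1Image : NonUnitalSubalgebra ℂ (L2 H →L[ℂ] L2 H) where
  carrier := {T | ∃ f : ℕ → C₀(X, ℂ),
    Summable (fun n => ‖f n‖) ∧ T = ∑' n, monomial hφ ρ n (f n)}
  zero_mem' := ⟨0, by simp, by
    have h (n : ℕ) : monomial hφ ρ n 0 = 0 := by
      simpa using monomial_smul hφ ρ n 0 0
    simp [h]⟩
  add_mem' := by
    rintro _ _ ⟨f, hf, rfl⟩ ⟨g, hg, rfl⟩
    refine ⟨fun n => f n + g n, (hf.add hg).of_nonneg_of_le (fun _ => norm_nonneg _)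
      (fun n => norm_add_le _ _), ?_⟩
    simp only [monomial_add]
    exact ((summable_norm_monomial hφ ρ hf).of_norm.tsum_add
      (summable_norm_monomial hφ ρ hg).of_norm).symm
  smul_mem' := by
    rintro c _ ⟨f, hf, rfl⟩
    refine ⟨fun n => c • f n, by simpa only [norm_smul] using hf.mul_left ‖c‖, ?_⟩
    simp only [monomial_smul]
    exact ((summable_norm_monomial hφ ρ hf).of_norm.tsum_const_smul c).symm
  mul_mem' := by
    rintro _ _ ⟨f, hf, rfl⟩ ⟨g, hg, rfl⟩
    refine ⟨fun n => ∑ kl ∈ Finset.HasAntidiagonal.antidiagonal n, alpha hφ kl.2 (f kl.1) * g kl.2, ?_, ?_⟩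
    · have h := summable_norm_sum_mul_antidiagonal_of_summable_norm
        (f := fun n => ‖f n‖) (g := fun n => ‖g n‖) (by simpa using hf) (by simpa using hg)
      refine h.of_nonneg_of_le (fun _ => norm_nonneg _) fun n => ?_
      refine (norm_sum_le _ _).trans (le_trans ?_ (le_abs_self _))
      refine Finset.sum_le_sum fun kl _ => (norm_mul_le _ _).trans ?_
      exact mul_le_mul_of_nonneg_right (norm_alpha_le hφ _ _) (norm_nonneg _)
    · rw [tsum_mul_tsum_eq_tsum_sum_antidiagonal_of_summable_norm
        (summable_norm_monomial hφ ρ hf) (summable_norm_monomial hφ ρ hg)]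
      refine tsum_congr fun n => ?_
      rw [monomial_sum]
      refine Finset.sum_congr rfl fun kl hkl => ?_
      rw [monomial_mul, Finset.HasAntidiagonal.mem_antidiagonal.1 hkl]

/-- The analytic crossed product `C_0(X) ×_φ ℤ₊`: the norm closure of the image of
`ℓ¹(ℤ₊, C_0(X))` in the bounded operators on `H ⊗ ℓ²(ℤ₊)`. -/
def crossedProduct : NonUnitalSubalgebra ℂ (L2 H →L[ℂ] L2 H) :=
  (l1Image hφ ρ).topologicalClosure

theorem entry_monomial (m n : ℕ) (f : C₀(X, ℂ)) :
    entry m (monomial hφ ρ n f) = if m = n then ρ f else 0 := by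
  ext x
  rw [entry_apply, monomial_single, alpha_zero, zero_add, lp.single_apply, Pi.single_apply]
  split_ifs <;> rfl

theorem entry_tsum {f : ℕ → C₀(X, ℂ)} (hf : Summable fun n => ‖f n‖) (m : ℕ) :
    entry m (∑' n, monomial hφ ρ n (f n)) = ρ (f m) := by
  rw [(entry m).map_tsum (summable_norm_monomial hφ ρ hf).of_norm,
    tsum_eq_single m fun n hn => by rw [entry_monomial, if_neg hn.symm], entry_monomial,
    if_pos rfl]

variable {ρ}

/-- A faithful action `ρ` of `C_0(X)`, as a linear isometry onto its range. -/
def toIsometry (hρ : Function.Injective ρ) : C₀(X, ℂ) →ₗᵢ[ℂ] (H →L[ℂ] H) where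
  toFun := ρ
  map_add' := map_add ρ
  map_smul' := map_smul ρ
  norm_map' := NonUnitalStarAlgHom.norm_map ρ hρ

theorem entry_mem_range (hρ : Function.Injective ρ) (n : ℕ) (T : crossedProduct hφ ρ) :
    entry n (T : L2 H →L[ℂ] L2 H) ∈ LinearMap.range (toIsometry hρ).toLinearMap := by
  have hcl : IsClosed (LinearMap.range (toIsometry hρ).toLinearMap : Set (H →L[ℂ] H)) := by
    have h := (toIsometry hρ).isometry.isClosedEmbedding.isClosed_range
    rw [LinearMap.coe_range]
    exact h
  have hsub : closure (l1Image hφ ρ : Set (L2 H →L[ℂ] L2 H)) ⊆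
      (entry n) ⁻¹' (LinearMap.range (toIsometry hρ).toLinearMap : Set (H →L[ℂ] H)) := by
    refine closure_minimal ?_ (hcl.preimage (entry n).continuous)
    rintro _ ⟨f, hf, rfl⟩
    exact ⟨f n, (entry_tsum hφ ρ hf n).symm⟩
  exact hsub T.2

/-- The `n`-th Fourier coefficient map `E_n : C_0(X) ×_φ ℤ₊ → C_0(X)`: `E_n(T)` is the function
`f` for which `ρ f` is the `(n, 0)` matrix entry of `T`. By `fourierCoeff_tsum` and
`norm_fourierCoeff_le` below, it is the continuous extension of the contraction
`∑ U^k f_k ↦ f_n` on `ℓ¹(ℤ₊, C_0(X))`. -/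
def fourierCoeff (hρ : Function.Injective ρ) (n : ℕ) : crossedProduct hφ ρ →ₗ[ℂ] C₀(X, ℂ) :=
  (toIsometry hρ).equivRange.symm.toLinearEquiv.toLinearMap ∘ₗ
    LinearMap.codRestrict (LinearMap.range (toIsometry hρ).toLinearMap)
      ((entry n).toLinearMap ∘ₗ (crossedProduct hφ ρ).toSubmodule.subtype)
      (entry_mem_range hφ hρ n)

theorem apply_fourierCoeff (hρ : Function.Injective ρ) (n : ℕ) (T : crossedProduct hφ ρ) :
    ρ (fourierCoeff hφ hρ n T) = entry n (T : L2 H →L[ℂ] L2 H) := by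
  have h := (toIsometry hρ).equivRange.apply_symm_apply
    ⟨entry n (T : L2 H →L[ℂ] L2 H), entry_mem_range hφ hρ n T⟩
  exact congrArg Subtype.val h

theorem norm_fourierCoeff_le (hρ : Function.Injective ρ) (n : ℕ) (T : crossedProduct hφ ρ) :
    ‖fourierCoeff hφ hρ n T‖ ≤ ‖(T : L2 H →L[ℂ] L2 H)‖ := by
  rw [← NonUnitalStarAlgHom.norm_map ρ hρ, apply_fourierCoeff]
  exact norm_entry_le n _

theorem fourierCoeff_tsum (hρ : Function.Injective ρ) {f : ℕ → C₀(X, ℂ)}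
    (hf : Summable fun n => ‖f n‖) (n : ℕ) (T : crossedProduct hφ ρ)
    (hT : (T : L2 H →L[ℂ] L2 H) = ∑' k, monomial hφ ρ k (f k)) :
    fourierCoeff hφ hρ n T = f n := by
  apply hρ
  rw [apply_fourierCoeff, hT, entry_tsum hφ ρ hf]

end CrossedProduct

end AnalyticCrossedProduct

/-!
The Jacobson radical of the analytic crossed product `A = C_0(X) ×_φ ℤ₊`.

The radical is determined by monomials. It is invariant under the gauge automorphisms
`U^n f ↦ z^n U^n f` and closed (`isClosed_jacobsonRadical`), and `U^n E_n(T)` is the limit of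
averages of gauge translates of `T` over roots of unity; so `T ∈ Rad A` implies
`U^n E_n(T) ∈ Rad A` (`mono_fourierCoeff_mem_jacobsonRadical`). Conversely `T` is the limit of the
Abel means `∑ r^n U^n E_n(T)`, which are contractive by the maximum modulus principle
(`mem_jacobsonRadical_of_forall_mono_mem`).

Elements of the radical are quasinilpotent (`tendsto_norm_pow_of_mem_jacobsonRadical`). As `E_0` is
multiplicative, it vanishes on the radical. If `f` does not vanish at the recurrent point `x`, then
return times `a_k` of `x` can be chosen such that the words `w_{k+1} = w_k a_{k+1} w_k` keep `x`
near itself; the product of `∑ 2^(-k-1) U^(a_k - n) g` with `U^n |f|²` has nonnegative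
coefficients, and along these words its powers decay only geometrically, so that it is not
quasinilpotent (`apply_eq_zero_of_mono_mem_jacobsonRadical`).

For the other inclusion let `J` be the closed ideal of all `f` with `U f ∈ Rad A`, and `Y` its zero
set, so that `J` consists of the functions that vanish on `Y` (`mem_of_vanishing_on_zeros`). The
radical is semiprime: `T A T ⊆ Rad A` implies `T ∈ Rad A`. If an open set `V` meets `Y` and no point
of `V ∩ Y` returned to `V`, then for `f` supported in `V` all coefficients `α_{k+1}(f) α_1(g) f` of
`U f U^k g U f` would vanish on `Y`, which gives `U f ∈ Rad A` and contradicts `V ∩ Y ≠ ∅`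
(`exists_iterate_mem_of_zeros_radicalIdeal`). Hence for each `ε > 0` the points of `Y` that return
to within `ε` of themselves are dense in `Y`, and by Baire's theorem so are the recurrent ones.
Functions vanishing on the recurrent points therefore vanish on `Y` and lie in `J`.
-/

namespace AnalyticCrossedProduct


/-! ### The Jacobson radical: ideal structure and quasi-inverses -/

section AlgebraicRadical

universe u

variable {A : Type u} [NonUnitalRing A] [Module ℂ A]

section Representations

variable {V : Type*} [AddCommGroup V] [Module ℂ V] {π : A →ₙₐ[ℂ] Module.End ℂ V}

/-- In an irreducible representation every nonzero vector is cyclic. -/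
theorem IsIrreducibleRep.exists_apply_eq (hπ : IsIrreducibleRep π) {v : V} (hv : v ≠ 0) (w : V) :
    ∃ b : A, π b v = w := by
  obtain ⟨⟨a₀, ha₀⟩, hirr⟩ := hπ
  let N : Submodule ℂ V :=
    { carrier := {w | ∀ a : A, π a w = 0}
      zero_mem' := fun a => map_zero _
      add_mem' := fun {x y} hx hy a => by rw [map_add, hx a, hy a, add_zero]
      smul_mem' := fun c x hx a => by rw [map_smul, hx a, smul_zero] }
  have hN : N = ⊥ := by
    refine (hirr N fun a w hw b => by rw [hw a, map_zero]).resolve_right fun h => ha₀ ?_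
    ext w
    have hw : w ∈ N := h ▸ Submodule.mem_top
    exact hw a₀
  let W : Submodule ℂ V :=
    { carrier := {w | ∃ b : A, π b v = w}
      zero_mem' := ⟨0, by simp⟩
      add_mem' := by
        rintro _ _ ⟨b, rfl⟩ ⟨c, rfl⟩
        exact ⟨b + c, by simp⟩
      smul_mem' := by
        rintro c _ ⟨b, rfl⟩
        exact ⟨c • b, by simp⟩ }
  rcases hirr W (by rintro a _ ⟨b, rfl⟩; exact ⟨a * b, by simp⟩) with h | h
  · refine absurd ?_ hv
    have hvN : v ∈ N := fun a => by
      have : π a v ∈ W := ⟨a, rfl⟩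
      rwa [h, Submodule.mem_bot] at this
    rwa [hN, Submodule.mem_bot] at hvN
  · have hw : w ∈ W := h ▸ Submodule.mem_top
    exact hw

theorem IsIrreducibleRep.comp {A' : Type*} [NonUnitalRing A'] [Module ℂ A']
    (hπ : IsIrreducibleRep π) (θ : A' →ₙₐ[ℂ] A) (hθ : Function.Surjective θ) :
    IsIrreducibleRep (π.comp θ) := by
  obtain ⟨⟨a, ha⟩, hirr⟩ := hπ
  refine ⟨?_, fun W hW => hirr W fun b w hw => ?_⟩
  · obtain ⟨a', rfl⟩ := hθ a
    exact ⟨a', ha⟩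
  · obtain ⟨b', rfl⟩ := hθ b
    exact hW b' w hw

end Representations

theorem zero_mem_jacobsonRadical : (0 : A) ∈ jacobsonRadical A := fun _ _ _ π _ => map_zero π

theorem add_mem_jacobsonRadical {a b : A} (ha : a ∈ jacobsonRadical A)
    (hb : b ∈ jacobsonRadical A) : a + b ∈ jacobsonRadical A := fun V _ _ π hπ => by
  rw [map_add, ha V π hπ, hb V π hπ, add_zero]

theorem smul_mem_jacobsonRadical (c : ℂ) {a : A} (ha : a ∈ jacobsonRadical A) :
    c • a ∈ jacobsonRadical A := fun V _ _ π hπ => by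
  rw [map_smul, ha V π hπ, smul_zero]

theorem mul_mem_jacobsonRadical_left (b : A) {a : A} (ha : a ∈ jacobsonRadical A) :
    b * a ∈ jacobsonRadical A := fun V _ _ π hπ => by
  rw [map_mul, ha V π hπ, mul_zero]

theorem mul_mem_jacobsonRadical_right (b : A) {a : A} (ha : a ∈ jacobsonRadical A) :
    a * b ∈ jacobsonRadical A := fun V _ _ π hπ => by
  rw [map_mul, ha V π hπ, zero_mul]

theorem sum_mem_jacobsonRadical {ι : Type*} (s : Finset ι) {f : ι → A}
    (hf : ∀ i ∈ s, f i ∈ jacobsonRadical A) : ∑ i ∈ s, f i ∈ jacobsonRadical A :=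
  Finset.sum_induction f (· ∈ jacobsonRadical A) (fun _ _ => add_mem_jacobsonRadical)
    zero_mem_jacobsonRadical hf

/-- The Jacobson radical is a semiprime ideal. -/
theorem mem_jacobsonRadical_of_forall_mul_mul {a : A}
    (h : ∀ b : A, a * b * a ∈ jacobsonRadical A) : a ∈ jacobsonRadical A := by
  intro V _ _ π hπ
  by_contra hne
  obtain ⟨v, hv⟩ : ∃ v, π a v ≠ 0 := by
    by_contra! hall
    exact hne (LinearMap.ext hall)
  obtain ⟨b, hb⟩ := hπ.exists_apply_eq hv v
  have h0 := congrArg (fun T : Module.End ℂ V => T v) (h b V π hπ)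
  simp only [map_mul, Module.End.mul_apply, hb, LinearMap.zero_apply] at h0
  exact hv h0

theorem map_mem_jacobsonRadical {A' : Type u} [NonUnitalRing A'] [Module ℂ A']
    (θ : A' →ₙₐ[ℂ] A) (hθ : Function.Surjective θ) {a : A'} (ha : a ∈ jacobsonRadical A') :
    θ a ∈ jacobsonRadical A := fun V _ _ π hπ =>
  ha V (π.comp θ) (hπ.comp θ hθ)

variable [IsScalarTower ℂ A A] [SMulCommClass ℂ A A]

/-- The representation of `A` by left multiplication on the quotient by a left ideal `L`. -/
def leftQuotientRep (L : Submodule ℂ A) (hL : ∀ a, ∀ w ∈ L, a * w ∈ L) :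
    A →ₙₐ[ℂ] Module.End ℂ (A ⧸ L) where
  toFun a := L.mapQ L (LinearMap.mulLeft ℂ a) (hL a)
  map_smul' c a := Submodule.linearMap_qext _ <| LinearMap.ext fun x =>
    congrArg L.mkQ (smul_mul_assoc c a x)
  map_zero' := Submodule.linearMap_qext _ <| LinearMap.ext fun x =>
    congrArg L.mkQ (zero_mul x)
  map_add' a b := Submodule.linearMap_qext _ <| LinearMap.ext fun x =>
    congrArg L.mkQ (add_mul a b x)
  map_mul' a b := Submodule.linearMap_qext _ <| LinearMap.ext fun x =>
    congrArg L.mkQ (mul_assoc a b x)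

theorem leftQuotientRep_mk (L : Submodule ℂ A) (hL : ∀ a, ∀ w ∈ L, a * w ∈ L) (a x : A) :
    leftQuotientRep L hL a (Submodule.Quotient.mk x) = Submodule.Quotient.mk (a * x) := rfl

/-- If `a` is in the radical, then `1 + b` is a left inverse of `1 - a` for some `b`. Otherwise
a left ideal containing all `c - c a` and maximal among those without `a` would give an
irreducible representation that does not kill `a`. -/
theorem exists_eq_add_mul_of_mem_jacobsonRadical {a : A} (ha : a ∈ jacobsonRadical A) :
    ∃ b : A, b = a + b * a := by
  by_contra! hno
  let L₀ : Submodule ℂ A := LinearMap.range (LinearMap.id - LinearMap.mulRight ℂ a)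
  have hL₀ (c : A) : c - c * a ∈ L₀ := ⟨c, by simp⟩
  let S : Set (Submodule ℂ A) := {L | L₀ ≤ L ∧ (∀ b, ∀ w ∈ L, b * w ∈ L) ∧ a ∉ L}
  have hS₀ : L₀ ∈ S := by
    refine ⟨le_rfl, ?_, ?_⟩
    · rintro b _ ⟨c, rfl⟩
      have := hL₀ (b * c)
      simpa [mul_sub, mul_assoc] using this
    · rintro ⟨c, hc⟩
      refine hno c ?_
      rw [← sub_eq_iff_eq_add]
      simpa using hc
  obtain ⟨L, -, hLmax⟩ := zorn_le_nonempty₀ S (by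
    intro c hcS hc y hy
    refine ⟨sSup c, ⟨(hcS hy).1.trans (le_sSup hy), ?_, ?_⟩, fun z hz => le_sSup hz⟩
    · intro b w hw
      rw [Submodule.mem_sSup_of_directed ⟨y, hy⟩ hc.directedOn] at hw ⊢
      obtain ⟨z, hz, hwz⟩ := hw
      exact ⟨z, hz, (hcS hz).2.1 b w hwz⟩
    · intro hw
      rw [Submodule.mem_sSup_of_directed ⟨y, hy⟩ hc.directedOn] at hw
      obtain ⟨z, hz, hwz⟩ := hw
      exact (hcS hz).2.2 hwz) L₀ hS₀
  obtain ⟨⟨hL1, hL2, hL3⟩, hmax⟩ := hLmax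
  -- `a` is a right unit modulo `L`, so `a * a ∈ L` would give `a ∈ L`
  have haa : a * a ∉ L := fun h => hL3 (by
    have := L.add_mem (hL1 (hL₀ a)) h
    simpa using this)
  have hne : leftQuotientRep L hL2 a ≠ 0 := fun h => haa (by
    have := congrArg (fun T => T (Submodule.Quotient.mk a)) h
    rw [leftQuotientRep_mk, LinearMap.zero_apply, Submodule.Quotient.mk_eq_zero] at this
    exact this)
  refine hne (ha _ (leftQuotientRep L hL2) ⟨⟨a, hne⟩, fun W hW => ?_⟩)
  let W' : Submodule ℂ A := W.comap L.mkQ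
  have hLW : L ≤ W' := fun x hx => by
    have : L.mkQ x = 0 := (Submodule.Quotient.mk_eq_zero L).2 hx
    simp [W', this]
  have hW' (b w : A) (hw : w ∈ W') : b * w ∈ W' := hW b _ hw
  by_cases haW : a ∈ W'
  · right
    rw [eq_top_iff]
    rintro x -
    obtain ⟨c, rfl⟩ := L.mkQ_surjective x
    have := W'.add_mem (hLW (hL1 (hL₀ c))) (hW' c a haW)
    rw [sub_add_cancel] at this
    exact this
  · left
    have hle : W' ≤ L := hmax ⟨hL1.trans hLW, hW', haW⟩ hLW
    rw [eq_bot_iff]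
    intro x hx
    obtain ⟨c, rfl⟩ := L.mkQ_surjective x
    exact (Submodule.mem_bot ℂ).2 ((Submodule.Quotient.mk_eq_zero L).2 (hle hx))

/-- If `a` is in the radical, then `1 - a` has a two-sided inverse `1 + b`. -/
theorem exists_quasiInverse_of_mem_jacobsonRadical {a : A} (ha : a ∈ jacobsonRadical A) :
    ∃ b : A, b = a + b * a ∧ b = a + a * b := by
  obtain ⟨b, hb⟩ := exists_eq_add_mul_of_mem_jacobsonRadical ha
  have hbR : b ∈ jacobsonRadical A := by
    rw [hb]
    exact add_mem_jacobsonRadical ha (mul_mem_jacobsonRadical_left b ha)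
  obtain ⟨c, hc⟩ := exists_eq_add_mul_of_mem_jacobsonRadical
    (a := -b) (by simpa using smul_mem_jacobsonRadical (-1) hbR)
  refine ⟨b, hb, ?_⟩
  -- `1 + c` and `1 - a` are both equal to the inverse of `1 + b`
  have hca : c = -a := by
    have h1 : c * b = -b - c := by
      rw [mul_neg] at hc
      rw [eq_sub_iff_add_eq, eq_neg_iff_add_eq_zero]
      nth_rewrite 2 [hc]
      abel
    have h2 : c * b * a = c * b - c * a := by
      rw [mul_assoc, ← mul_sub]
      congr 1
      exact eq_sub_of_add_eq' hb.symm
    rw [h1, sub_mul, neg_mul, sub_left_inj] at h2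
    have h3 : c = b * a - b := by
      rw [eq_sub_iff_add_eq', ← neg_inj, h2]
      abel
    rw [h3]
    nth_rewrite 2 [hb]
    abel
  rw [hca, neg_mul_neg] at hc
  rw [← neg_add_eq_iff_eq_add]
  rw [← neg_add_eq_iff_eq_add, neg_neg] at hc
  rw [← hc]
  abel

end AlgebraicRadical

/-! ### The Jacobson radical of a closed subalgebra of a Banach algebra -/

section BanachRadical

open Filter Topology

variable {B : Type*} [NormedRing B] [NormedAlgebra ℂ B] [CompleteSpace B]
  {A : NonUnitalSubalgebra ℂ B}

/-- Elements of the Jacobson radical are quasinilpotent, by Gelfand's formula. -/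
theorem tendsto_norm_pow_of_mem_jacobsonRadical {a : A} (ha : a ∈ jacobsonRadical A) :
    Tendsto (fun n : ℕ => ‖(a : B) ^ n‖ ^ (1 / n : ℝ)) atTop (𝓝 0) := by
  have hunit (c : ℂ) : IsUnit (1 - c • (a : B)) := by
    obtain ⟨b, hb1, hb2⟩ :=
      exists_quasiInverse_of_mem_jacobsonRadical (smul_mem_jacobsonRadical c ha)
    have h1 : (b : B) = c • (a : B) + b * (c • (a : B)) := congrArg Subtype.val hb1
    have h2 : (b : B) = c • (a : B) + (c • (a : B)) * b := congrArg Subtype.val hb2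
    refine ⟨⟨1 - c • (a : B), 1 + b, ?_, ?_⟩, rfl⟩
    · rw [sub_mul, one_mul, mul_add, mul_one, ← h2, add_sub_cancel_right]
    · rw [mul_sub, mul_one, add_mul, one_mul, ← h1, add_sub_cancel_right]
  have hspec : spectralRadius ℂ (a : B) = 0 := by
    refine le_antisymm (iSup₂_le fun k hk => ?_) bot_le
    by_contra hk0
    have hk' : k ≠ 0 := fun h => hk0 (by simp [h])
    refine hk ?_
    rw [spectrum.mem_resolventSet_iff]
    have h := (hunit k⁻¹).smul (Units.mk0 k hk')
    rw [Units.smul_mk0, smul_sub, smul_smul, mul_inv_cancel₀ hk', one_smul] at h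
    rwa [Algebra.algebraMap_eq_smul_one]
  have h := spectrum.pow_norm_pow_one_div_tendsto_nhds_spectralRadius (a : B)
  rw [hspec] at h
  have h' := (ENNReal.tendsto_toReal ENNReal.zero_ne_top).comp h
  refine h'.congr fun n => ?_
  exact ENNReal.toReal_ofReal (by positivity)

/-- If the powers of `a` do not decay faster than geometrically, then `a` is not in the radical. -/
theorem notMem_jacobsonRadical_of_le_norm_pow {a : A} {c : ℝ} (hc : 0 < c)
    (h : ∃ᶠ n : ℕ in atTop, c ^ n ≤ ‖(a : B) ^ n‖) : a ∉ jacobsonRadical A := by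
  intro ha
  have hlim := (tendsto_norm_pow_of_mem_jacobsonRadical ha).eventually_lt_const hc
  obtain ⟨n, hn, hlt, hn1⟩ := (h.and_eventually (hlim.and (eventually_ge_atTop 1))).exists
  refine absurd hlt (not_lt.2 ?_)
  have hn0 : n ≠ 0 := by omega
  calc c = (c ^ n) ^ (1 / n : ℝ) := by
        rw [one_div, Real.pow_rpow_inv_natCast hc.le hn0]
    _ ≤ _ := Real.rpow_le_rpow (by positivity) hn (by positivity)

theorem exists_eq_add_mul_of_norm_lt_one (hA : IsClosed (A : Set B)) (a : A)
    (ha : ‖(a : B)‖ < 1) : ∃ b : A, b = a + b * a := by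
  have hs : Summable fun n : ℕ => (a : B) ^ n := summable_geometric_of_norm_lt_one ha
  have hmem (n : ℕ) : (a : B) ^ (n + 1) ∈ A := by
    induction n with
    | zero => simp
    | succ n ih =>
      rw [pow_succ]
      exact A.mul_mem ih a.2
  have hs1 : Summable fun n : ℕ => (a : B) ^ (n + 1) := (summable_nat_add_iff 1).2 hs
  have hbmem : ∑' n : ℕ, (a : B) ^ (n + 1) ∈ A := by
    refine hA.mem_of_tendsto hs1.hasSum.tendsto_sum_nat (Eventually.of_forall fun n => ?_)
    exact sum_mem fun i _ => hmem i
  refine ⟨⟨_, hbmem⟩, Subtype.ext ?_⟩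
  change ∑' n : ℕ, (a : B) ^ (n + 1) = a + (∑' n : ℕ, (a : B) ^ (n + 1)) * a
  rw [← hs1.tsum_mul_right, hs1.tsum_eq_zero_add]
  simp [pow_succ]

theorem isClosed_jacobsonRadical (hA : IsClosed (A : Set B)) : IsClosed (jacobsonRadical A) := by
  refine isClosed_of_closure_subset fun a ha V _ _ π hπ => ?_
  by_contra hne
  obtain ⟨v, hv⟩ : ∃ v, π a v ≠ 0 := by
    by_contra! hall
    exact hne (LinearMap.ext hall)
  obtain ⟨b, hb⟩ := hπ.exists_apply_eq hv v
  -- `b a` fixes `v`; a multiple `b (a - a')` of norm less than one would fix `v` as well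
  obtain ⟨a', ha', hdist⟩ := Metric.mem_closure_iff.1 ha (1 / (‖b‖ + 1)) (by positivity)
  have hlt : ‖((b * (a - a') : A) : B)‖ < 1 := by
    have h1 : ‖b * (a - a')‖ ≤ ‖b‖ * ‖a - a'‖ := norm_mul_le _ _
    rw [dist_eq_norm] at hdist
    have h2 : ‖b‖ * ‖a - a'‖ ≤ ‖b‖ * (1 / (‖b‖ + 1)) := by gcongr
    have h3 : ‖b‖ * (1 / (‖b‖ + 1)) < 1 := by
      rw [mul_one_div, div_lt_one (by positivity)]
      linarith
    exact (h1.trans h2).trans_lt h3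
  obtain ⟨d, hd⟩ := exists_eq_add_mul_of_norm_lt_one hA _ hlt
  have hfix : π (b * (a - a')) v = v := by
    rw [map_mul, map_sub, ha' V π hπ, sub_zero, Module.End.mul_apply, hb]
  have h0 : π d v = v + π d v := by
    conv_lhs => rw [hd]
    rw [map_add, map_mul π d, LinearMap.add_apply, Module.End.mul_apply, hfix]
  have hv0 : v = 0 := by simpa using h0.symm
  exact hv (by rw [hv0, map_zero])

end BanachRadical


/-! ### Monomials and Fourier coefficients in the crossed product -/

noncomputable section Coefficients

open Filter Topology

variable {X : Type*} [TopologicalSpace X] {φ : X → X} (hφ : IsProperMap φ)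
  {H : Type*} [NormedAddCommGroup H] [InnerProductSpace ℂ H] [CompleteSpace H]
  (ρ : C₀(X, ℂ) →⋆ₙₐ[ℂ] (H →L[ℂ] H))

variable {hφ ρ} in
theorem norm_smul_crossedProduct (c : ℂ) (T : crossedProduct hφ ρ) : ‖c • T‖ = ‖c‖ * ‖T‖ :=
  norm_smul c (T : L2 H →L[ℂ] L2 H)

theorem isClosed_crossedProduct :
    IsClosed (crossedProduct hφ ρ : Set (L2 H →L[ℂ] L2 H)) :=
  (l1Image hφ ρ).isClosed_topologicalClosure

instance : CompleteSpace (crossedProduct hφ ρ) :=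
  (isClosed_crossedProduct hφ ρ).completeSpace_coe

theorem monomial_zero (n : ℕ) : monomial hφ ρ n 0 = 0 := by
  simpa using monomial_smul hφ ρ n 0 0

theorem monomial_mem_crossedProduct (n : ℕ) (f : C₀(X, ℂ)) :
    monomial hφ ρ n f ∈ crossedProduct hφ ρ := by
  refine (l1Image hφ ρ).le_topologicalClosure ⟨Pi.single n f, ?_, ?_⟩
  · refine summable_of_ne_finset_zero (s := {n}) fun k hk => ?_
    rw [Pi.single_eq_of_ne (by simpa using hk), norm_zero]
  · rw [tsum_eq_single n fun k hk => by rw [Pi.single_eq_of_ne hk, monomial_zero],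
      Pi.single_eq_same]

/-- The operator `π(U^n f)` as an element of the crossed product. -/
def mono (n : ℕ) : C₀(X, ℂ) →ₗ[ℂ] crossedProduct hφ ρ where
  toFun f := ⟨monomial hφ ρ n f, monomial_mem_crossedProduct hφ ρ n f⟩
  map_add' f g := Subtype.ext (monomial_add hφ ρ n f g)
  map_smul' c f := Subtype.ext (monomial_smul hφ ρ n c f)

theorem coe_mono (n : ℕ) (f : C₀(X, ℂ)) :
    (mono hφ ρ n f : L2 H →L[ℂ] L2 H) = monomial hφ ρ n f := rfl

theorem norm_mono_le (n : ℕ) (f : C₀(X, ℂ)) : ‖mono hφ ρ n f‖ ≤ ‖f‖ :=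
  norm_monomial_le hφ ρ n f

theorem mono_mul_mono (n m : ℕ) (f g : C₀(X, ℂ)) :
    mono hφ ρ n f * mono hφ ρ m g = mono hφ ρ (n + m) (alpha hφ m f * g) :=
  Subtype.ext (monomial_mul hφ ρ n m f g)

theorem continuous_mono (n : ℕ) : Continuous (mono hφ ρ n) :=
  AddMonoidHomClass.continuous_of_bound _ 1 fun f => by
    rw [one_mul]
    exact norm_mono_le hφ ρ n f

theorem continuous_alpha (n : ℕ) : Continuous (alpha hφ n) :=
  AddMonoidHomClass.continuous_of_bound _ 1 fun f => by
    simpa using norm_alpha_le hφ n f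

/-- Polynomials `∑ U^n f_n` are dense in the crossed product. -/
theorem dense_range_sum_mono : Dense {T : crossedProduct hφ ρ |
    ∃ (N : ℕ) (f : ℕ → C₀(X, ℂ)), T = ∑ n ∈ Finset.range N, mono hφ ρ n (f n)} := by
  have hcl : IsClosed (Subtype.val '' closure {T : crossedProduct hφ ρ |
      ∃ (N : ℕ) (f : ℕ → C₀(X, ℂ)), T = ∑ n ∈ Finset.range N, mono hφ ρ n (f n)}) :=
    (isClosed_crossedProduct hφ ρ).isClosedEmbedding_subtypeVal.isClosedMap _ isClosed_closure
  have hsub : closure (l1Image hφ ρ : Set (L2 H →L[ℂ] L2 H)) ⊆ _ := closure_minimal (by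
    rintro _ ⟨f, hf, rfl⟩
    refine hcl.mem_of_tendsto
      (summable_norm_monomial hφ ρ hf).of_norm.hasSum.tendsto_sum_nat
      (Eventually.of_forall fun N => ⟨∑ n ∈ Finset.range N, mono hφ ρ n (f n),
        subset_closure ⟨N, f, rfl⟩, ?_⟩)
    exact map_sum (crossedProduct hφ ρ).toSubmodule.subtype _ _) hcl
  intro T
  obtain ⟨T', hT', h⟩ := hsub T.2
  rwa [← Subtype.ext h]

variable {hφ ρ} in
/-- A closed additive condition holds on the crossed product if it holds for all `U^n f`. -/
theorem crossedProduct_induction {P : crossedProduct hφ ρ → Prop}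
    (hcl : IsClosed {T | P T}) (hadd : ∀ S T, P S → P T → P (S + T))
    (hmono : ∀ n f, P (mono hφ ρ n f)) (T : crossedProduct hφ ρ) : P T := by
  refine closure_minimal ?_ hcl (dense_range_sum_mono hφ ρ T)
  rintro _ ⟨N, f, rfl⟩
  refine Finset.sum_induction _ P hadd ?_ fun n _ => hmono n (f n)
  simpa using hmono 0 0

variable {ρ} (hρ : Function.Injective ρ)

theorem continuous_fourierCoeff (n : ℕ) : Continuous (fourierCoeff hφ hρ n) :=
  AddMonoidHomClass.continuous_of_bound _ 1 fun T => by
    simpa using norm_fourierCoeff_le hφ hρ n T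

theorem fourierCoeff_mono (m n : ℕ) (f : C₀(X, ℂ)) :
    fourierCoeff hφ hρ m (mono hφ ρ n f) = if m = n then f else 0 := by
  apply hρ
  rw [apply_fourierCoeff, coe_mono, entry_monomial]
  split_ifs <;> simp

theorem fourierCoeff_sum_mono (N : ℕ) (f : ℕ → C₀(X, ℂ)) (m : ℕ) :
    fourierCoeff hφ hρ m (∑ n ∈ Finset.range N, mono hφ ρ n (f n)) =
      if m < N then f m else 0 := by
  simp [map_sum, fourierCoeff_mono]

/-- The Fourier coefficients of a product: a twisted convolution. -/
theorem fourierCoeff_mul (n : ℕ) (S T : crossedProduct hφ ρ) :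
    fourierCoeff hφ hρ n (S * T) = ∑ kl ∈ Finset.HasAntidiagonal.antidiagonal n,
      alpha hφ kl.2 (fourierCoeff hφ hρ kl.1 S) * fourierCoeff hφ hρ kl.2 T := by
  have hE := continuous_fourierCoeff hφ hρ
  have hα := continuous_alpha hφ
  induction S using crossedProduct_induction with
  | hcl =>
    refine isClosed_eq ((hE n).comp (continuous_id.mul continuous_const)) ?_
    exact continuous_finsetSum _ fun kl _ =>
      ((hα kl.2).comp (hE kl.1)).mul continuous_const
  | hadd S S' hS hS' =>
    simp only [add_mul, map_add, hS, hS', Finset.sum_add_distrib]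
  | hmono i f =>
    induction T using crossedProduct_induction with
    | hcl =>
      refine isClosed_eq ((hE n).comp (continuous_const.mul continuous_id)) ?_
      exact continuous_finsetSum _ fun kl _ => continuous_const.mul (hE kl.2)
    | hadd T T' hT hT' =>
      simp only [mul_add, map_add, hT, hT', Finset.sum_add_distrib]
    | hmono j g =>
      rw [mono_mul_mono, fourierCoeff_mono]
      split_ifs with h
      · rw [Finset.sum_eq_single (i, j)]
        · simp [fourierCoeff_mono]
        · rintro ⟨k, l⟩ - hne
          by_cases hk : k = i
          · have hl : l ≠ j := fun hl => hne (by rw [hk, hl])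
            simp [fourierCoeff_mono, hl]
          · simp [fourierCoeff_mono, hk]
        · intro h'
          exact absurd (Finset.HasAntidiagonal.mem_antidiagonal.2 h.symm) h'
      · refine (Finset.sum_eq_zero ?_).symm
        rintro ⟨k, l⟩ hkl
        rw [Finset.HasAntidiagonal.mem_antidiagonal] at hkl
        by_cases hk : k = i
        · have hl : l ≠ j := fun hl => h (by rw [← hkl, ← hk, ← hl])
          simp [fourierCoeff_mono, hl]
        · simp [fourierCoeff_mono, hk]

end Coefficients

/-! ### The gauge action -/

noncomputable section Gauge

open Filter Topology

variable {H : Type*} [NormedAddCommGroup H] [InnerProductSpace ℂ H]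

/-- The unitary `ξ ⊗ e_k ↦ z^k ξ ⊗ e_k`, for `z` on the unit circle. -/
def gaugeUnitary (z : Circle) : L2 H →L[ℂ] L2 H :=
  lp.mapCLM 2 (fun k : ℕ => ((z : ℂ) ^ k) • ContinuousLinearMap.id ℂ H) zero_le_one (fun k => by
    rw [norm_smul, norm_pow, Circle.norm_coe, one_pow, one_mul]
    exact ContinuousLinearMap.norm_id_le)

theorem norm_gaugeUnitary_le (z : Circle) : ‖gaugeUnitary (H := H) z‖ ≤ 1 :=
  lp.norm_mapCLM_le _ _ _ _

theorem gaugeUnitary_single (z : Circle) (k : ℕ) (ξ : H) :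
    gaugeUnitary z (lp.single 2 k ξ) = lp.single 2 k ((z : ℂ) ^ k • ξ) := by
  ext j
  rcases eq_or_ne j k with rfl | h
  · simp [gaugeUnitary]
  · simp [gaugeUnitary, lp.single_apply, h]

theorem gaugeUnitary_mul_inv (z : Circle) :
    gaugeUnitary (H := H) z * gaugeUnitary z⁻¹ = 1 := by
  refine clm_ext_single fun k ξ => ?_
  rw [mul_apply_eq_comp, gaugeUnitary_single, gaugeUnitary_single, smul_smul, ← mul_pow,
    Circle.coe_inv, mul_inv_cancel₀ (Circle.coe_ne_zero z), one_pow, one_smul]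
  rfl

variable [CompleteSpace H] {X : Type*} [TopologicalSpace X] {φ : X → X} (hφ : IsProperMap φ)
  (ρ : C₀(X, ℂ) →⋆ₙₐ[ℂ] (H →L[ℂ] H))

theorem gaugeUnitary_mul_monomial (z : Circle) (n : ℕ) (f : C₀(X, ℂ)) :
    gaugeUnitary z * monomial hφ ρ n f * gaugeUnitary z⁻¹ =
      (z : ℂ) ^ n • monomial hφ ρ n f := by
  refine clm_ext_single fun k ξ => ?_
  simp only [mul_apply_eq_comp, gaugeUnitary_single, monomial_single, map_smul, smul_smul,
    smul_apply, ← lp.single_smul]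
  congr 2
  rw [pow_add, mul_comm ((z : ℂ) ^ k), mul_assoc, ← mul_pow, Circle.coe_inv,
    mul_inv_cancel₀ (Circle.coe_ne_zero z), one_pow, mul_one]

/-- The gauge automorphism `U^n f ↦ z^n U^n f` of the crossed product. -/
def gauge (z : Circle) : crossedProduct hφ ρ →ₙₐ[ℂ] crossedProduct hφ ρ where
  toFun T := ⟨gaugeUnitary z * (T : L2 H →L[ℂ] L2 H) * gaugeUnitary z⁻¹, by
    induction T using crossedProduct_induction with
    | hcl =>
      exact (isClosed_crossedProduct hφ ρ).preimage (by fun_prop)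
    | hadd S T hS hT =>
      have := add_mem hS hT
      rwa [← add_mul, ← mul_add] at this
    | hmono n f =>
      rw [coe_mono, gaugeUnitary_mul_monomial]
      exact (crossedProduct hφ ρ).smul_mem _ (monomial_mem_crossedProduct hφ ρ n f)⟩
  map_smul' c T := Subtype.ext (by simp)
  map_zero' := Subtype.ext (by simp)
  map_add' S T := Subtype.ext (by simp [mul_add, add_mul])
  map_mul' S T := Subtype.ext (by
    have h : gaugeUnitary (H := H) z⁻¹ * gaugeUnitary z = 1 := by
      simpa using gaugeUnitary_mul_inv (H := H) z⁻¹
    calc gaugeUnitary z * ((S : L2 H →L[ℂ] L2 H) * (T : L2 H →L[ℂ] L2 H)) * gaugeUnitary z⁻¹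
        = gaugeUnitary z * (S : L2 H →L[ℂ] L2 H) * 1 * (T : L2 H →L[ℂ] L2 H) *
            gaugeUnitary z⁻¹ := by
          simp only [mul_one, mul_assoc]
      _ = _ := by
          rw [← h]
          simp only [mul_assoc]
          rfl)

theorem coe_gauge (z : Circle) (T : crossedProduct hφ ρ) :
    (gauge hφ ρ z T : L2 H →L[ℂ] L2 H) =
      gaugeUnitary z * (T : L2 H →L[ℂ] L2 H) * gaugeUnitary z⁻¹ := rfl

theorem gauge_mono (z : Circle) (n : ℕ) (f : C₀(X, ℂ)) :
    gauge hφ ρ z (mono hφ ρ n f) = (z : ℂ) ^ n • mono hφ ρ n f :=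
  Subtype.ext (gaugeUnitary_mul_monomial hφ ρ z n f)

theorem norm_gauge_le (z : Circle) (T : crossedProduct hφ ρ) : ‖gauge hφ ρ z T‖ ≤ ‖T‖ := by
  change ‖gaugeUnitary z * (T : L2 H →L[ℂ] L2 H) * gaugeUnitary z⁻¹‖ ≤ ‖(T : L2 H →L[ℂ] L2 H)‖
  calc _ ≤ ‖gaugeUnitary z * (T : L2 H →L[ℂ] L2 H)‖ * 1 :=
        (norm_mul_le _ _).trans (by gcongr; exact norm_gaugeUnitary_le _)
    _ ≤ 1 * ‖(T : L2 H →L[ℂ] L2 H)‖ * 1 := by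
        gcongr
        exact (norm_mul_le _ _).trans (by gcongr; exact norm_gaugeUnitary_le _)
    _ = _ := by ring

theorem gauge_surjective (z : Circle) : Function.Surjective (gauge hφ ρ z) := fun T => by
  refine ⟨gauge hφ ρ z⁻¹ T, Subtype.ext ?_⟩
  have h := gaugeUnitary_mul_inv (H := H) z
  rw [coe_gauge, coe_gauge, inv_inv]
  calc _ = (gaugeUnitary (H := H) z * gaugeUnitary z⁻¹) * (T : L2 H →L[ℂ] L2 H) *
        (gaugeUnitary z * gaugeUnitary z⁻¹) := by simp only [mul_assoc]
    _ = _ := by rw [h, one_mul, mul_one]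

end Gauge


/-! ### Averages over the gauge action and Abel means -/

section Approximation

open Filter Topology

/-- Convergence to zero of a bounded family of additive maps is a closed condition. -/
theorem isClosed_setOf_tendsto_zero {E F ι : Type*} [SeminormedAddCommGroup E]
    [SeminormedAddCommGroup F] {l : Filter ι} (Φ : ι → E →+ F) (C : ℝ)
    (hΦ : ∀ᶠ i in l, ∀ x, ‖Φ i x‖ ≤ C * ‖x‖) :
    IsClosed {x | Tendsto (fun i => Φ i x) l (𝓝 0)} := by
  refine isClosed_of_closure_subset fun x hx => ?_
  rw [Set.mem_ofPred_eq, NormedAddGroup.tendsto_nhds_zero]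
  intro ε hε
  obtain ⟨y, hy, hxy⟩ := Metric.mem_closure_iff.1 hx (ε / (2 * (|C| + 1))) (by positivity)
  rw [Set.mem_ofPred_eq, NormedAddGroup.tendsto_nhds_zero] at hy
  filter_upwards [hΦ, hy (ε / 2) (by positivity)] with i hi hiy
  rw [dist_eq_norm, lt_div_iff₀ (by positivity)] at hxy
  have h1 : ‖Φ i x‖ ≤ ‖Φ i (x - y)‖ + ‖Φ i y‖ := by
    rw [map_sub]
    simpa using norm_add_le (Φ i x - Φ i y) (Φ i y)
  have h2 : C * ‖x - y‖ ≤ (|C| + 1) * ‖x - y‖ := by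
    gcongr
    linarith [le_abs_self C]
  linarith [hi (x - y)]

end Approximation

noncomputable section Averages

open Filter Topology

variable {X : Type*} [TopologicalSpace X] {φ : X → X} (hφ : IsProperMap φ)
  {H : Type*} [NormedAddCommGroup H] [InnerProductSpace ℂ H] [CompleteSpace H]

/-- The primitive `N`-th root of unity `exp (2πi / N)`. -/
def rootOfUnity (N : ℕ) : Circle := Circle.exp (2 * Real.pi / N)

theorem isPrimitiveRoot_rootOfUnity {N : ℕ} (hN : N ≠ 0) :
    IsPrimitiveRoot (rootOfUnity N : ℂ) N := by
  have h := Complex.isPrimitiveRoot_exp N hN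
  have h2 : (rootOfUnity N : ℂ) = Complex.exp (2 * Real.pi * Complex.I / N) := by
    rw [rootOfUnity, Circle.coe_exp]
    congr 1
    push_cast
    ring
  rwa [h2]

section

variable (ρ : C₀(X, ℂ) →⋆ₙₐ[ℂ] (H →L[ℂ] H))

/-- The average `(1/N) ∑_j ω^{-jn} θ_{ω^j}(T)` of the gauge action over the `N`-th roots of
unity, which keeps the coefficients whose index is congruent to `n` modulo `N`. -/
def gaugeAverage (n N : ℕ) : crossedProduct hφ ρ →ₗ[ℂ] crossedProduct hφ ρ :=
  (N : ℂ)⁻¹ • ∑ j ∈ Finset.range N, (((rootOfUnity N : ℂ) ^ n)⁻¹ ^ j) •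
    LinearMapClass.linearMap (gauge hφ ρ (rootOfUnity N ^ j))

theorem gaugeAverage_apply (n N : ℕ) (T : crossedProduct hφ ρ) :
    gaugeAverage hφ ρ n N T = (N : ℂ)⁻¹ • ∑ j ∈ Finset.range N,
      (((rootOfUnity N : ℂ) ^ n)⁻¹ ^ j) • gauge hφ ρ (rootOfUnity N ^ j) T := by
  rw [gaugeAverage, LinearMap.smul_apply, LinearMap.sum_apply]
  rfl

theorem norm_gaugeAverage_le (n N : ℕ) (T : crossedProduct hφ ρ) :
    ‖gaugeAverage hφ ρ n N T‖ ≤ ‖T‖ := by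
  rw [gaugeAverage_apply, norm_smul_crossedProduct]
  have h : ‖∑ j ∈ Finset.range N,
      (((rootOfUnity N : ℂ) ^ n)⁻¹ ^ j) • gauge hφ ρ (rootOfUnity N ^ j) T‖ ≤ N * ‖T‖ := by
    refine (norm_sum_le _ _).trans ?_
    rw [← nsmul_eq_mul, ← Finset.card_range N, ← Finset.sum_const, Finset.card_range]
    refine Finset.sum_le_sum fun j _ => ?_
    refine (norm_smul_crossedProduct _ _).trans_le ?_
    rw [norm_pow, norm_inv, norm_pow, Circle.norm_coe, one_pow, inv_one, one_pow,
      one_mul]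
    exact norm_gauge_le hφ ρ _ T
  rcases Nat.eq_zero_or_pos N with rfl | hN
  · rw [Nat.cast_zero, inv_zero, norm_zero, zero_mul]
    exact norm_nonneg _
  · rw [norm_inv, Complex.norm_natCast, inv_mul_le_iff₀ (by positivity)]
    exact h

theorem gaugeAverage_mono {n m N : ℕ} (hn : n < N) (hm : m < N) (f : C₀(X, ℂ)) :
    gaugeAverage hφ ρ n N (mono hφ ρ m f) = if n = m then mono hφ ρ m f else 0 := by
  have hω := isPrimitiveRoot_rootOfUnity (N := N) (by omega)
  have hω0 : (rootOfUnity N : ℂ) ≠ 0 := Circle.coe_ne_zero _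
  set ω : ℂ := (rootOfUnity N : ℂ) with hωdef
  have hN : (N : ℂ) ≠ 0 := Nat.cast_ne_zero.2 (by omega)
  have hsum : gaugeAverage hφ ρ n N (mono hφ ρ m f) =
      ((N : ℂ)⁻¹ * ∑ j ∈ Finset.range N, ((ω ^ n)⁻¹ * ω ^ m) ^ j) • mono hφ ρ m f := by
    rw [gaugeAverage_apply, ← smul_smul, Finset.sum_smul]
    congr 1
    refine Finset.sum_congr rfl fun j _ => ?_
    rw [gauge_mono, smul_smul, Circle.coe_pow, mul_pow, ← hωdef, ← pow_mul ω j, ← pow_mul ω m,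
      mul_comm j m]
  rw [hsum]
  split_ifs with h
  · subst h
    rw [inv_mul_cancel₀ (pow_ne_zero _ hω0)]
    simp [hN]
  · have hne : (ω ^ n)⁻¹ * ω ^ m ≠ 1 := fun h1 => h (by
      refine hω.pow_inj hn hm ?_
      have := (inv_mul_eq_one₀ (pow_ne_zero n hω0)).1 h1
      exact this)
    have hpow : ((ω ^ n)⁻¹ * ω ^ m) ^ N = 1 := by
      rw [mul_pow, inv_pow, ← pow_mul, ← pow_mul, mul_comm n, mul_comm m, pow_mul, pow_mul,
        hω.pow_eq_one]
      simp
    rw [geom_sum_eq hne, hpow, sub_self, zero_div, mul_zero, zero_smul]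

end

variable {ρ : C₀(X, ℂ) →⋆ₙₐ[ℂ] (H →L[ℂ] H)} (hρ : Function.Injective ρ)

theorem tendsto_gaugeAverage (n : ℕ) (T : crossedProduct hφ ρ) :
    Tendsto (fun N => gaugeAverage hφ ρ n N T) atTop
      (𝓝 (mono hφ ρ n (fourierCoeff hφ hρ n T))) := by
  rw [← tendsto_sub_nhds_zero_iff]
  let Φ (N : ℕ) : crossedProduct hφ ρ →+ crossedProduct hφ ρ :=
    (gaugeAverage hφ ρ n N - mono hφ ρ n ∘ₗ fourierCoeff hφ hρ n).toAddMonoidHom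
  change Tendsto (fun N => Φ N T) atTop (𝓝 0)
  induction T using crossedProduct_induction with
  | hcl =>
    refine isClosed_setOf_tendsto_zero Φ 2 (Eventually.of_forall fun N T => ?_)
    calc ‖Φ N T‖ ≤ ‖gaugeAverage hφ ρ n N T‖ + ‖mono hφ ρ n (fourierCoeff hφ hρ n T)‖ :=
          norm_sub_le _ _
      _ ≤ ‖T‖ + ‖T‖ := add_le_add (norm_gaugeAverage_le hφ ρ n N T)
          ((norm_mono_le hφ ρ _ _).trans (norm_fourierCoeff_le hφ hρ n T))
      _ = 2 * ‖T‖ := (two_mul _).symm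
  | hadd S T hS hT => simpa only [map_add, add_zero] using hS.add hT
  | hmono m f =>
    refine tendsto_const_nhds.congr' ?_
    filter_upwards [eventually_gt_atTop n, eventually_gt_atTop m] with N hn hm
    change _ = gaugeAverage hφ ρ n N (mono hφ ρ m f) -
      mono hφ ρ n (fourierCoeff hφ hρ n (mono hφ ρ m f))
    rw [gaugeAverage_mono hφ ρ hn hm, fourierCoeff_mono]
    split_ifs with h
    · rw [h, sub_self]
    · rw [map_zero, sub_self]

/-- The radical is gauge invariant and closed, so it contains the homogeneous components of each
of its elements. -/
theorem mono_fourierCoeff_mem_jacobsonRadical {T : crossedProduct hφ ρ}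
    (hT : T ∈ jacobsonRadical (crossedProduct hφ ρ)) (n : ℕ) :
    mono hφ ρ n (fourierCoeff hφ hρ n T) ∈ jacobsonRadical (crossedProduct hφ ρ) := by
  refine (isClosed_jacobsonRadical (isClosed_crossedProduct hφ ρ)).mem_of_tendsto
    (tendsto_gaugeAverage hφ hρ n T) (Eventually.of_forall fun N => ?_)
  rw [gaugeAverage_apply]
  exact smul_mem_jacobsonRadical _ (sum_mem_jacobsonRadical _ fun j _ =>
    smul_mem_jacobsonRadical _ (map_mem_jacobsonRadical _ (gauge_surjective hφ ρ _) hT))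

theorem summable_abel {r : ℝ} (hr0 : 0 ≤ r) (hr1 : r < 1) (T : crossedProduct hφ ρ) :
    Summable fun n : ℕ => mono hφ ρ n ((r : ℂ) ^ n • fourierCoeff hφ hρ n T) := by
  refine Summable.of_norm_bounded
    (((summable_geometric_of_lt_one hr0 hr1).mul_right ‖T‖)) fun n => ?_
  refine (norm_mono_le hφ ρ _ _).trans ?_
  rw [norm_smul, norm_pow, Complex.norm_real, Real.norm_of_nonneg hr0]
  gcongr
  exact norm_fourierCoeff_le hφ hρ n T

/-- The Abel mean `∑ r^n U^n E_n(T)` of the Fourier series of `T`. -/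
def abelMean (r : ℝ) (T : crossedProduct hφ ρ) : crossedProduct hφ ρ :=
  ∑' n : ℕ, mono hφ ρ n ((r : ℂ) ^ n • fourierCoeff hφ hρ n T)

theorem abelMean_add {r : ℝ} (hr0 : 0 ≤ r) (hr1 : r < 1) (S T : crossedProduct hφ ρ) :
    abelMean hφ hρ r (S + T) = abelMean hφ hρ r S + abelMean hφ hρ r T := by
  refine Eq.trans (tsum_congr fun n => ?_)
    ((summable_abel hφ hρ hr0 hr1 S).tsum_add (summable_abel hφ hρ hr0 hr1 T))
  rw [map_add, ← map_add (mono hφ ρ n)]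
  congr 1
  ext x
  exact mul_add _ _ _

theorem abelMean_sum_mono (r : ℝ) (N : ℕ) (f : ℕ → C₀(X, ℂ)) :
    abelMean hφ hρ r (∑ n ∈ Finset.range N, mono hφ ρ n (f n)) =
      ∑ n ∈ Finset.range N, mono hφ ρ n ((r : ℂ) ^ n • f n) := by
  rw [abelMean, tsum_eq_sum (s := Finset.range N) fun n hn => by
    rw [fourierCoeff_sum_mono, if_neg (by simpa using hn), smul_zero, map_zero]]
  refine Finset.sum_congr rfl fun n hn => ?_
  rw [fourierCoeff_sum_mono, if_pos (by simpa using hn)]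

/-- Abel means are contractive: for a polynomial `∑ U^n f_n` the function `z ↦ ∑ z^n U^n f_n` has
constant norm on the unit circle by gauge invariance, and the maximum modulus principle
applies. -/
theorem norm_abelMean_le {r : ℝ} (hr0 : 0 ≤ r) (hr1 : r < 1) (T : crossedProduct hφ ρ) :
    ‖abelMean hφ hρ r T‖ ≤ ‖T‖ := by
  let Φ : crossedProduct hφ ρ →+ crossedProduct hφ ρ :=
    AddMonoidHom.mk' (abelMean hφ hρ r) (abelMean_add hφ hρ hr0 hr1)
  have hcont : Continuous Φ := by
    refine AddMonoidHomClass.continuous_of_bound Φ (∑' n : ℕ, r ^ n) fun T => ?_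
    rw [← tsum_mul_right]
    have hs := (summable_geometric_of_lt_one hr0 hr1).mul_right ‖T‖
    refine tsum_of_norm_bounded hs.hasSum fun n => ?_
    refine (norm_mono_le hφ ρ _ _).trans ?_
    rw [norm_smul, norm_pow, Complex.norm_real, Real.norm_of_nonneg hr0]
    gcongr
    exact norm_fourierCoeff_le hφ hρ n T
  have hcl : IsClosed {T | ‖Φ T‖ ≤ ‖T‖} := isClosed_le hcont.norm continuous_norm
  refine closure_minimal ?_ hcl (dense_range_sum_mono hφ ρ T)
  rintro _ ⟨N, f, rfl⟩
  change ‖abelMean hφ hρ r _‖ ≤ _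
  rw [abelMean_sum_mono]
  set S := ∑ n ∈ Finset.range N, mono hφ ρ n (f n) with hS
  let F : ℂ → (L2 H →L[ℂ] L2 H) := fun z =>
    ∑ n ∈ Finset.range N, z ^ n • monomial hφ ρ n (f n)
  have hFcoe (z : ℂ) : F z =
      ((∑ n ∈ Finset.range N, mono hφ ρ n (z ^ n • f n) : crossedProduct hφ ρ) :
        L2 H →L[ℂ] L2 H) := by
    simp only [F, ← monomial_smul]
    exact (map_sum (crossedProduct hφ ρ).toSubmodule.subtype
      (fun n => mono hφ ρ n (z ^ n • f n)) _).symm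
  have hF : Differentiable ℂ F := by
    refine Differentiable.fun_sum fun n _ => ?_
    exact (differentiable_id.pow n).smul_const _
  change ‖((_ : crossedProduct hφ ρ) : L2 H →L[ℂ] L2 H)‖ ≤ _
  rw [← hFcoe]
  refine Complex.norm_le_of_forall_mem_frontier_norm_le (U := Metric.ball 0 1)
    Metric.isBounded_ball hF.diffContOnCl (C := ‖S‖) (fun z hz => ?_) (z := (r : ℂ)) ?_
  · rw [frontier_ball _ one_ne_zero] at hz
    obtain ⟨w, rfl⟩ : ∃ w : Circle, (w : ℂ) = z :=
      ⟨⟨z, by simpa [Submonoid.unitSphere] using hz⟩, rfl⟩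
    have hFz : gauge hφ ρ w S = ∑ n ∈ Finset.range N, mono hφ ρ n ((w : ℂ) ^ n • f n) := by
      rw [hS, map_sum]
      exact Finset.sum_congr rfl fun n _ => by rw [gauge_mono, map_smul]
    rw [hFcoe, ← hFz]
    exact norm_gauge_le hφ ρ w S
  · refine subset_closure ?_
    simpa [abs_of_nonneg hr0] using hr1

theorem tendsto_abelMean (T : crossedProduct hφ ρ) :
    Tendsto (fun r : ℝ => abelMean hφ hρ r T) (𝓝[Set.Ico 0 1] 1) (𝓝 T) := by
  rw [← tendsto_sub_nhds_zero_iff]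
  let Φ (r : Set.Ico (0 : ℝ) 1) : crossedProduct hφ ρ →+ crossedProduct hφ ρ :=
    AddMonoidHom.mk' (fun T => abelMean hφ hρ r T - T) fun S T => by
      rw [abelMean_add hφ hρ r.2.1 r.2.2]; abel
  have key : Tendsto (fun r => Φ r T) (comap Subtype.val (𝓝 1)) (𝓝 0) := by
    induction T using crossedProduct_induction with
    | hcl =>
      refine isClosed_setOf_tendsto_zero Φ 2 (Eventually.of_forall fun r T => ?_)
      calc ‖Φ r T‖ ≤ ‖abelMean hφ hρ r T‖ + ‖T‖ := norm_sub_le _ _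
        _ ≤ ‖T‖ + ‖T‖ := by
          gcongr
          exact norm_abelMean_le hφ hρ r.2.1 r.2.2 T
        _ = 2 * ‖T‖ := (two_mul _).symm
    | hadd S T hS hT => simpa only [map_add, add_zero] using hS.add hT
    | hmono m f =>
      have h (r : ℝ) : abelMean hφ hρ r (mono hφ ρ m f) = mono hφ ρ m ((r : ℂ) ^ m • f) := by
        rw [abelMean, tsum_eq_single m fun n hn => by
          rw [fourierCoeff_mono, if_neg hn, smul_zero, map_zero], fourierCoeff_mono, if_pos rfl]
      change Tendsto (fun r : Set.Ico (0 : ℝ) 1 =>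
        abelMean hφ hρ r (mono hφ ρ m f) - mono hφ ρ m f) _ _
      simp only [h]
      have hc : Continuous fun r : ℝ => mono hφ ρ m ((r : ℂ) ^ m • f) - mono hφ ρ m f :=
        ((continuous_mono hφ ρ m).comp (by fun_prop)).sub continuous_const
      have hc1 := hc.tendsto 1
      rw [Complex.ofReal_one, one_pow, one_smul, sub_self] at hc1
      exact hc1.comp tendsto_comap
  rw [nhdsWithin, ← map_comap_setCoe_val]
  exact tendsto_map'_iff.2 key

/-- If all homogeneous components of `T` are in the radical, so is `T`. -/
theorem mem_jacobsonRadical_of_forall_mono_mem {T : crossedProduct hφ ρ}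
    (hT : ∀ n, mono hφ ρ n (fourierCoeff hφ hρ n T) ∈ jacobsonRadical (crossedProduct hφ ρ)) :
    T ∈ jacobsonRadical (crossedProduct hφ ρ) := by
  have hcl := isClosed_jacobsonRadical (isClosed_crossedProduct hφ ρ)
  have hne : (𝓝[Set.Ico (0 : ℝ) 1] 1).NeBot := by
    rw [← mem_closure_iff_nhdsWithin_neBot, closure_Ico zero_ne_one]
    simp
  refine hcl.mem_of_tendsto (tendsto_abelMean hφ hρ T) ?_
  filter_upwards [self_mem_nhdsWithin] with r hr
  refine hcl.mem_of_tendsto (summable_abel hφ hρ hr.1 hr.2 T).hasSum.tendsto_sum_nat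
    (Eventually.of_forall fun N => ?_)
  exact sum_mem_jacobsonRadical _ fun n _ => by
    rw [map_smul]
    exact smul_mem_jacobsonRadical _ (hT n)

end Averages


/-! ### The radical vanishes at recurrent points -/

section Recurrence

open Filter Topology

variable {X : Type*} [TopologicalSpace X] {φ : X → X}

/-- A recurrent point returns to each of its neighbourhoods at arbitrarily late times. -/
theorem exists_le_iterate_mem_of_mem_recurrentPoints [T1Space X] {x : X}
    (hx : x ∈ recurrentPoints φ) {V : Set X} (hV : V ∈ 𝓝 x) (N : ℕ) :
    ∃ n, N ≤ n ∧ φ^[n] x ∈ V := by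
  by_cases hper : ∃ p, 1 ≤ p ∧ φ^[p] x = x
  · obtain ⟨p, hp, hpx⟩ := hper
    refine ⟨p * N, Nat.le_mul_of_pos_left N hp, ?_⟩
    rw [Function.iterate_mul, Function.iterate_fixed hpx]
    exact mem_of_mem_nhds hV
  · push Not at hper
    have hfin : ((fun i => φ^[i] x) '' Set.Ico 1 N).Finite := (Set.finite_Ico 1 N).image _
    have hnx : x ∉ (fun i => φ^[i] x) '' Set.Ico 1 N := by
      rintro ⟨i, hi, hix⟩
      exact hper i hi.1 hix
    obtain ⟨n, hn1, hnV, hn⟩ := hx _ (inter_mem hV (hfin.isClosed.isOpen_compl.mem_nhds hnx))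
    refine ⟨n, ?_, hnV⟩
    by_contra! hlt
    exact hn ⟨n, ⟨hn1, hlt⟩, rfl⟩

/-- A recurrent point has return times `a k ≥ n` to the open set `V` which can be composed
according to the words `w_0 = a_0`, `w_{k+1} = w_k a_{k+1} w_k`: here `L k` is the total length of
`w_k`, and the orbits of the points of the neighbourhood `W k` are in `V` after each prefix
of `w_k`. -/
theorem exists_returnTimes [T1Space X] (hφ : Continuous φ) {x : X} (hx : x ∈ recurrentPoints φ)
    {V : Set X} (hVo : IsOpen V) (hxV : x ∈ V) (n : ℕ) :
    ∃ (a L : ℕ → ℕ) (W : ℕ → Set X), L 0 = a 0 ∧ ∀ k, n ≤ a k ∧ L (k + 1) = L k + a (k + 1) + L k ∧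
      x ∈ W k ∧ W k ⊆ V ∧ (∀ y ∈ W k, φ^[L k] y ∈ V) ∧
      ∀ y ∈ W (k + 1), y ∈ W k ∧ φ^[L k + a (k + 1)] y ∈ W k := by
  let Good : ℕ × ℕ × Set X → Prop := fun s => n ≤ s.1 ∧ IsOpen s.2.2 ∧ x ∈ s.2.2 ∧ s.2.2 ⊆ V ∧
    ∀ y ∈ s.2.2, φ^[s.2.1] y ∈ V
  obtain ⟨a₀, ha₀, ha₀V⟩ :=
    exists_le_iterate_mem_of_mem_recurrentPoints hx (hVo.mem_nhds hxV) n
  have h₀ : Good (a₀, a₀, V ∩ φ^[a₀] ⁻¹' V) :=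
    ⟨ha₀, hVo.inter (hVo.preimage (hφ.iterate a₀)), ⟨hxV, ha₀V⟩, Set.inter_subset_left,
      fun y hy => hy.2⟩
  have hstep (s : {s // Good s}) : ∃ t : {t // Good t},
      t.1.2.1 = s.1.2.1 + t.1.1 + s.1.2.1 ∧
        ∀ y ∈ t.1.2.2, y ∈ s.1.2.2 ∧ φ^[s.1.2.1 + t.1.1] y ∈ s.1.2.2 := by
    obtain ⟨⟨a, L, W⟩, ha, hWo, hxW, hWV, hLW⟩ := s
    obtain ⟨r, hr, hrW⟩ :=
      exists_le_iterate_mem_of_mem_recurrentPoints hx (hWo.mem_nhds hxW) (L + n)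
    obtain ⟨b, rfl⟩ := Nat.exists_eq_add_of_le (le_of_add_le_left hr)
    refine ⟨⟨(b, L + b + L, W ∩ φ^[L + b] ⁻¹' W), by dsimp only at *; omega,
      hWo.inter (hWo.preimage (hφ.iterate _)), ⟨hxW, hrW⟩,
      Set.inter_subset_left.trans hWV, fun y hy => ?_⟩, rfl, fun y hy => hy⟩
    have := hLW _ hy.2
    rw [← Function.iterate_add_apply] at this
    convert this using 2
    dsimp only
    omega
  choose next hnext using hstep
  let s : ℕ → {s // Good s} := fun k => Nat.rec ⟨_, h₀⟩ (fun _ t => next t) k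
  refine ⟨fun k => (s k).1.1, fun k => (s k).1.2.1, fun k => (s k).1.2.2, rfl, fun k => ?_⟩
  obtain ⟨h1, -, h3, h4, h5⟩ := (s k).2
  exact ⟨h1, (hnext (s k)).1, h3, h4, h5, (hnext (s k)).2⟩

end Recurrence

noncomputable section Positivity

open Filter Topology
open scoped ComplexOrder

theorem norm_apply_le_norm_zeroAtInfty {X : Type*} [TopologicalSpace X] (f : C₀(X, ℂ)) (x : X) :
    ‖f x‖ ≤ ‖f‖ := by
  rw [← ZeroAtInftyContinuousMap.norm_toBCF_eq_norm]
  exact f.toBCF.norm_coe_le_norm x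

/-- Evaluation at a point, as an additive map on `C_0(X)`. -/
def evalZeroAtInfty {X : Type*} [TopologicalSpace X] (x : X) : C₀(X, ℂ) →+ ℂ where
  toFun f := f x
  map_zero' := rfl
  map_add' _ _ := rfl

theorem continuous_evalZeroAtInfty {X : Type*} [TopologicalSpace X] (x : X) :
    Continuous (evalZeroAtInfty x) :=
  AddMonoidHomClass.continuous_of_bound _ 1 fun f => by
    rw [one_mul]
    exact norm_apply_le_norm_zeroAtInfty f x

/-- Urysohn's lemma for `C_0(X)`. -/
theorem exists_zeroAtInfty_bump {X : Type*} [TopologicalSpace X] [LocallyCompactSpace X]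
    [RegularSpace X] {U : Set X} (hU : IsOpen U) {p : X} (hp : p ∈ U) :
    ∃ g : C₀(X, ℂ), g p = 1 ∧ (∀ y ∉ U, g y = 0) ∧ ∀ y, 0 ≤ g y := by
  obtain ⟨u, hu1, hu0, hucs, hu⟩ := exists_continuous_one_zero_of_isCompact
    (isCompact_singleton (x := p)) hU.isClosed_compl
    (Set.disjoint_singleton_left.2 fun h => h hp)
  refine ⟨⟨⟨fun y => (u y : ℂ), by fun_prop⟩, ?_⟩, ?_, fun y hy => ?_, fun y => ?_⟩
  · have hcs : HasCompactSupport fun y => (u y : ℂ) := hucs.comp_left Complex.ofReal_zero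
    exact hcs.is_zero_at_infty
  · have : u p = 1 := hu1 rfl
    simp [this]
  · have : u y = 0 := hu0 hy
    simp [this]
  · exact Complex.zero_le_real.2 (hu y).1

variable {X : Type*} [TopologicalSpace X] {φ : X → X} (hφ : IsProperMap φ)
  {H : Type*} [NormedAddCommGroup H] [InnerProductSpace ℂ H] [CompleteSpace H]
  {ρ : C₀(X, ℂ) →⋆ₙₐ[ℂ] (H →L[ℂ] H)} (hρ : Function.Injective ρ)

theorem norm_fourierCoeff_apply_le (n : ℕ) (T : crossedProduct hφ ρ) (x : X) :
    ‖fourierCoeff hφ hρ n T x‖ ≤ ‖(T : L2 H →L[ℂ] L2 H)‖ :=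
  (norm_apply_le_norm_zeroAtInfty _ _).trans (norm_fourierCoeff_le hφ hρ n T)

theorem fourierCoeff_mul_apply (n : ℕ) (S T : crossedProduct hφ ρ) (x : X) :
    fourierCoeff hφ hρ n (S * T) x = ∑ kl ∈ Finset.HasAntidiagonal.antidiagonal n,
      fourierCoeff hφ hρ kl.1 S (φ^[kl.2] x) * fourierCoeff hφ hρ kl.2 T x := by
  rw [fourierCoeff_mul]
  exact map_sum (evalZeroAtInfty x) _ _

/-- `E_0` is multiplicative, so it maps quasinilpotent elements to zero. -/
theorem fourierCoeff_zero_of_mem_jacobsonRadical {T : crossedProduct hφ ρ}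
    (hT : T ∈ jacobsonRadical (crossedProduct hφ ρ)) : fourierCoeff hφ hρ 0 T = 0 := by
  ext x
  by_contra hne
  have hpos : 0 < ‖fourierCoeff hφ hρ 0 T x‖ := norm_pos_iff.2 hne
  have hpow (n : ℕ) : ∃ P : crossedProduct hφ ρ,
      (P : L2 H →L[ℂ] L2 H) = (T : L2 H →L[ℂ] L2 H) ^ (n + 1) ∧
        fourierCoeff hφ hρ 0 P x = fourierCoeff hφ hρ 0 T x ^ (n + 1) := by
    induction n with
    | zero => exact ⟨T, (pow_one _).symm, (pow_one _).symm⟩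
    | succ n ih =>
      obtain ⟨P, hP, hPx⟩ := ih
      refine ⟨P * T, ?_, ?_⟩
      · rw [pow_succ, ← hP]
        rfl
      · rw [fourierCoeff_mul_apply, Finset.Nat.antidiagonal_zero, Finset.sum_singleton,
          Function.iterate_zero, id_eq, hPx, ← pow_succ]
  refine notMem_jacobsonRadical_of_le_norm_pow hpos (Filter.Eventually.frequently ?_) hT
  filter_upwards [eventually_ge_atTop 1] with n hn
  obtain ⟨m, rfl⟩ := Nat.exists_eq_add_of_le' hn
  obtain ⟨P, hP, hPx⟩ := hpow m
  rw [← hP, ← norm_pow, ← hPx]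
  exact norm_fourierCoeff_apply_le hφ hρ 0 P x

/-- The operators all of whose Fourier coefficients are nonnegative functions. -/
def NonnegCoeffs (T : crossedProduct hφ ρ) : Prop :=
  ∀ n x, 0 ≤ fourierCoeff hφ hρ n T x

variable {hφ hρ}

theorem NonnegCoeffs.mul {S T : crossedProduct hφ ρ} (hS : NonnegCoeffs hφ hρ S)
    (hT : NonnegCoeffs hφ hρ T) : NonnegCoeffs hφ hρ (S * T) := fun n x => by
  rw [fourierCoeff_mul_apply]
  exact Finset.sum_nonneg fun kl _ => mul_nonneg (hS _ _) (hT _ _)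

theorem NonnegCoeffs.mul_le {S T : crossedProduct hφ ρ} (hS : NonnegCoeffs hφ hρ S)
    (hT : NonnegCoeffs hφ hρ T) (i j : ℕ) (x : X) :
    fourierCoeff hφ hρ i S (φ^[j] x) * fourierCoeff hφ hρ j T x ≤
      fourierCoeff hφ hρ (i + j) (S * T) x := by
  rw [fourierCoeff_mul_apply]
  exact Finset.single_le_sum (f := fun kl : ℕ × ℕ =>
    fourierCoeff hφ hρ kl.1 S (φ^[kl.2] x) * fourierCoeff hφ hρ kl.2 T x)
    (fun kl _ => mul_nonneg (hS _ _) (hT _ _))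
    (a := (i, j)) (Finset.HasAntidiagonal.mem_antidiagonal.2 rfl)

variable (hφ hρ)

/-- Let `M` have nonnegative coefficients, the one at the return time `a k` being at least
`c / 2^(k+1)` on `V`. In the power of `M` that belongs to the word `w_k` of `exists_returnTimes`
the factor for `a_j` occurs `2^(k-j)` times, and `∑ j 2^(-j)` converges; so the
coefficient at the length of `w_k` decays only geometrically in the exponent. -/
theorem le_fourierCoeff_pow_of_returnTimes {V : Set X} {a L : ℕ → ℕ} {W : ℕ → Set X}
    (hL0 : L 0 = a 0) (hL : ∀ k, L (k + 1) = L k + a (k + 1) + L k) (hWV : ∀ k, W k ⊆ V)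
    (hLW : ∀ k, ∀ y ∈ W k, φ^[L k] y ∈ V)
    (hW : ∀ k, ∀ y ∈ W (k + 1), y ∈ W k ∧ φ^[L k + a (k + 1)] y ∈ W k)
    {c : ℝ} (hc : 0 < c) {M : crossedProduct hφ ρ} (hM : NonnegCoeffs hφ hρ M)
    (hMa : ∀ k, ∀ y ∈ V, ((c / 2 ^ (k + 1) : ℝ) : ℂ) ≤ fourierCoeff hφ hρ (a k) M y) (k : ℕ) :
    ∃ P : crossedProduct hφ ρ,
      (P : L2 H →L[ℂ] L2 H) = (M : L2 H →L[ℂ] L2 H) ^ (2 ^ (k + 1) - 1) ∧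
      NonnegCoeffs hφ hρ P ∧ ∀ y ∈ W k,
        (((c / 4) ^ (2 ^ (k + 1) - 1) * 2 ^ (k + 1) : ℝ) : ℂ) ≤ fourierCoeff hφ hρ (L k) P y := by
  induction k with
  | zero =>
    refine ⟨M, by simp, hM, fun y hy => le_trans (le_of_eq ?_) (hL0 ▸ hMa 0 y (hWV 0 hy))⟩
    norm_num
    ring
  | succ k ih =>
    obtain ⟨P, hP, hPn, hPW⟩ := ih
    have hexp : 2 ^ (k + 1 + 1) - 1 = (2 ^ (k + 1) - 1) + 1 + (2 ^ (k + 1) - 1) := by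
      have : 1 ≤ 2 ^ (k + 1) := Nat.one_le_two_pow
      rw [pow_succ 2 (k + 1)]
      omega
    refine ⟨P * M * P, ?_, (hPn.mul hM).mul hPn, fun y hy => ?_⟩
    · rw [hexp, pow_add, pow_succ, ← hP]
      rfl
    · obtain ⟨hy1, hy2⟩ := hW k y hy
      set m := 2 ^ (k + 1) - 1
      have hd : (0 : ℝ) ≤ (c / 4) ^ m * 2 ^ (k + 1) := by positivity
      have h1 := (hPn.mul hM).mul_le hPn (L k + a (k + 1)) (L k) y
      have h2 := hPn.mul_le hM (L k) (a (k + 1)) (φ^[L k] y)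
      rw [← Function.iterate_add_apply, add_comm (a (k + 1))] at h2
      rw [hexp, hL k]
      refine le_trans ?_ h1
      have h3 : (((c / 4) ^ m * 2 ^ (k + 1) : ℝ) : ℂ) * ((c / 2 ^ (k + 1 + 1) : ℝ) : ℂ) ≤
          fourierCoeff hφ hρ (L k + a (k + 1)) (P * M) (φ^[L k] y) :=
        (mul_le_mul (hPW _ hy2) (hMa (k + 1) _ (hLW k y hy1))
          (Complex.zero_le_real.2 (by positivity)) (hPn _ _)).trans h2
      refine le_trans (le_of_eq ?_) (mul_le_mul h3 (hPW y hy1)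
        (Complex.zero_le_real.2 hd) (hPn.mul hM _ _))
      rw [← Complex.ofReal_mul, ← Complex.ofReal_mul]
      congr 1
      have h4 : (4 : ℝ) = 2 ^ 2 := by norm_num
      rw [pow_add, pow_succ]
      field_simp
      rw [h4]
      ring

/-- For `g ≥ 0` there is an operator with nonnegative coefficients, the one of index `m k` being
at least `2^(-k-1) g`: the sum of the operators `2^(-k-1) U^(m k) g`. -/
theorem exists_nonnegCoeffs_of_nonneg (m : ℕ → ℕ) {g : C₀(X, ℂ)} (hg : ∀ y, 0 ≤ g y) :
    ∃ B : crossedProduct hφ ρ, NonnegCoeffs hφ hρ B ∧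
      ∀ k y, (((1 / 2) ^ (k + 1) * ‖g y‖ : ℝ) : ℂ) ≤ fourierCoeff hφ hρ (m k) B y := by
  let t : ℕ → crossedProduct hφ ρ := fun k => mono hφ ρ (m k) (((1 / 2 : ℂ) ^ (k + 1)) • g)
  have ht : Summable t := by
    have hs : Summable fun k : ℕ => (1 / 2 : ℝ) ^ (k + 1) * ‖g‖ :=
      ((summable_nat_add_iff 1).2 summable_geometric_two).mul_right _
    refine Summable.of_norm_bounded hs fun k => (norm_mono_le hφ ρ _ _).trans_eq ?_
    rw [norm_smul, norm_pow]
    norm_num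
  have htc (n k : ℕ) (y : X) : fourierCoeff hφ hρ n (t k) y =
      if n = m k then (((1 / 2) ^ (k + 1) * ‖g y‖ : ℝ) : ℂ) else 0 := by
    rw [fourierCoeff_mono]
    split_ifs
    · have hgy : ((‖g y‖ : ℝ) : ℂ) = g y := RCLike.norm_of_nonneg' (hg y)
      rw [ZeroAtInftyContinuousMap.smul_apply, Complex.ofReal_mul, hgy]
      push_cast
      rfl
    · rfl
  have ht0 (n k : ℕ) (y : X) : 0 ≤ fourierCoeff hφ hρ n (t k) y := by
    rw [htc]
    split_ifs
    · exact Complex.zero_le_real.2 (by positivity)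
    · exact le_rfl
  have hsum (n : ℕ) (y : X) :
      HasSum (fun k => fourierCoeff hφ hρ n (t k) y) (fourierCoeff hφ hρ n (∑' k, t k) y) :=
    ht.hasSum.map ((evalZeroAtInfty y).comp (fourierCoeff hφ hρ n).toAddMonoidHom)
      ((continuous_evalZeroAtInfty y).comp (continuous_fourierCoeff hφ hρ n))
  refine ⟨∑' k, t k, fun n y => (hsum n y).nonneg fun k => ht0 n k y, fun k y => ?_⟩
  have h := le_hasSum (hsum (m k) y) k fun j _ => ht0 _ j _
  rwa [htc, if_pos rfl] at h

/-- If `f` does not vanish at the recurrent point `x`, then `U^n f` is not in the radical: for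
suitable return times `a_k`, the product of `∑ 2^(-k-1) U^(a_k - n) g` and `U^n |f|²` is not
quasinilpotent. -/
theorem apply_eq_zero_of_mono_mem_jacobsonRadical [LocallyCompactSpace X] [T2Space X]
    (hρ : Function.Injective ρ) {n : ℕ} {f : C₀(X, ℂ)}
    (hf : mono hφ ρ n f ∈ jacobsonRadical (crossedProduct hφ ρ)) {x : X}
    (hx : x ∈ recurrentPoints φ) : f x = 0 := by
  by_contra hfx
  obtain ⟨g, hgp, -, hg⟩ := exists_zeroAtInfty_bump isOpen_univ (Set.mem_univ (φ^[n] x))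
  have hφc := hφ.continuous
  let h : C₀(X, ℂ) := f * star f
  have hh (y : X) : h y = ((‖f y‖ ^ 2 : ℝ) : ℂ) := by
    change f y * (starRingEnd ℂ) (f y) = _
    rw [Complex.mul_conj, Complex.normSq_eq_norm_sq]
  have hhR : mono hφ ρ n h ∈ jacobsonRadical (crossedProduct hφ ρ) := by
    have := mul_mem_jacobsonRadical_right (mono hφ ρ 0 (star f)) hf
    rwa [mono_mul_mono, alpha_zero, add_zero] at this
  let c : ℝ := ‖f x‖ ^ 2 / 2
  have hc : 0 < c := by have := norm_pos_iff.2 hfx; positivity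
  let V : Set X := {y | c < ‖f y‖ ^ 2 * ‖g (φ^[n] y)‖}
  have hVo : IsOpen V := by
    have hi := hφc.iterate n
    exact isOpen_lt continuous_const
      (((map_continuous f).norm.pow 2).mul ((map_continuous g).comp hi).norm)
  have hxV : x ∈ V := by
    change c < _
    rw [hgp, norm_one, mul_one]
    have := norm_pos_iff.2 hfx
    exact half_lt_self (by positivity)
  obtain ⟨a, L, W, hL0, hseq⟩ := exists_returnTimes hφc hx hVo hxV n
  obtain ⟨B, hB, hBg⟩ := exists_nonnegCoeffs_of_nonneg hφ hρ (fun k => a k - n) hg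
  have hN : NonnegCoeffs hφ hρ (mono hφ ρ n h) := fun m y => by
    rw [fourierCoeff_mono]
    split_ifs
    · rw [hh]
      exact Complex.zero_le_real.2 (by positivity)
    · exact le_rfl
  have hMa (k : ℕ) (y : X) (hy : y ∈ V) : ((c / 2 ^ (k + 1) : ℝ) : ℂ) ≤
      fourierCoeff hφ hρ (a k) (B * mono hφ ρ n h) y := by
    have h1 := hB.mul_le hN (a k - n) n y
    rw [Nat.sub_add_cancel (hseq k).1, fourierCoeff_mono, if_pos rfl, hh] at h1
    refine le_trans ?_ h1
    refine le_trans ?_ (mul_le_mul_of_nonneg_right (hBg k (φ^[n] y))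
      (Complex.zero_le_real.2 (by positivity)))
    rw [← Complex.ofReal_mul, Complex.real_le_real, one_div, inv_pow, div_eq_inv_mul, mul_assoc]
    have hy' : c < ‖f y‖ ^ 2 * ‖g (φ^[n] y)‖ := hy
    rw [mul_comm ‖g _‖]
    gcongr
  refine notMem_jacobsonRadical_of_le_norm_pow (show 0 < c / 4 by positivity) ?_
    (mul_mem_jacobsonRadical_left B hhR)
  rw [frequently_atTop]
  intro N
  obtain ⟨P, hP, -, hPW⟩ := le_fourierCoeff_pow_of_returnTimes hφ hρ hL0
    (fun k => (hseq k).2.1) (fun k => (hseq k).2.2.2.1) (fun k => (hseq k).2.2.2.2.1)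
    (fun k => (hseq k).2.2.2.2.2) hc (hB.mul hN) hMa N
  refine ⟨2 ^ (N + 1) - 1, ?_, ?_⟩
  · have : N + 1 < 2 ^ (N + 1) := Nat.lt_two_pow_self
    omega
  · rw [← hP]
    refine le_trans ?_ (norm_fourierCoeff_apply_le hφ hρ (L N) P x)
    have h1 := hPW x (hseq N).2.2.1
    have h2 : (0 : ℝ) ≤ (c / 4) ^ (2 ^ (N + 1) - 1) := by positivity
    have h3 : (c / 4) ^ (2 ^ (N + 1) - 1) ≤ (c / 4) ^ (2 ^ (N + 1) - 1) * 2 ^ (N + 1) :=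
      le_mul_of_one_le_right h2 (one_le_pow₀ one_le_two)
    exact h3.trans ((Complex.le_def.1 h1).1.trans (Complex.re_le_norm _))

end Positivity


/-! ### Closed ideals of `C_0(X)` -/

section ClosedIdeals

open Filter Topology
open scoped ComplexOrder

variable {X : Type*} [TopologicalSpace X]

/-- A closed ideal of `C_0(X)` contains every function that vanishes on its zero set. -/
theorem mem_of_vanishing_on_zeros {J : Set C₀(X, ℂ)} (hcl : IsClosed J) (h0 : 0 ∈ J)
    (hadd : ∀ f ∈ J, ∀ g ∈ J, f + g ∈ J) (hmul : ∀ f ∈ J, ∀ g, f * g ∈ J) {f : C₀(X, ℂ)}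
    (hf : ∀ x, (∀ g ∈ J, g x = 0) → f x = 0) : f ∈ J := by
  rw [← hcl.closure_eq, Metric.mem_closure_iff]
  intro ε hε
  let K : Set X := {y | ε / 2 ≤ ‖f y‖}
  have hK : IsCompact K := by
    have h := (zero_at_infty f).eventually (Metric.ball_mem_nhds (0 : ℂ) (half_pos hε))
    obtain ⟨K', hK', hK'sub⟩ := mem_cocompact.1 h
    refine hK'.of_isClosed_subset (isClosed_le continuous_const (map_continuous f).norm) ?_
    intro y hy
    by_contra hyK'
    have := hK'sub hyK'
    rw [Set.mem_ofPred_eq, dist_zero_right] at this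
    exact absurd hy (not_le.2 this)
  obtain ⟨s, hsJ, hs0, hsK⟩ : ∃ s ∈ J, (∀ y, 0 ≤ s y) ∧ ∀ y ∈ K, s y ≠ 0 := by
    refine hK.induction_on (p := fun S => ∃ s ∈ J, (∀ y, 0 ≤ s y) ∧ ∀ y ∈ S, s y ≠ 0)
      ⟨0, h0, fun y => le_rfl, fun y hy => hy.elim⟩ ?_ ?_ ?_
    · rintro S S' hSS' ⟨s, hsJ, hs0, hs⟩
      exact ⟨s, hsJ, hs0, fun y hy => hs y (hSS' hy)⟩
    · rintro S S' ⟨s, hsJ, hs0, hs⟩ ⟨s', hsJ', hs0', hs'⟩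
      refine ⟨s + s', hadd s hsJ s' hsJ', fun y => add_nonneg (hs0 y) (hs0' y), ?_⟩
      rintro y hy hsum
      obtain ⟨h1, h2⟩ := (add_eq_zero_iff_of_nonneg (hs0 y) (hs0' y)).1 hsum
      rcases hy with hy | hy
      · exact hs y hy h1
      · exact hs' y hy h2
    · intro x hx
      have hfx : f x ≠ 0 := fun h => by
        have : ε / 2 ≤ ‖f x‖ := hx
        rw [h, norm_zero] at this
        linarith
      obtain ⟨g, hgJ, hgx⟩ : ∃ g ∈ J, g x ≠ 0 := by
        by_contra! hall
        exact hfx (hf x hall)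
      refine ⟨{y | g y ≠ 0}, mem_nhdsWithin_of_mem_nhds
        ((isOpen_ne_fun (map_continuous g) continuous_const).mem_nhds hgx),
        g * star g, hmul g hgJ _, fun y => ?_, fun y hy => ?_⟩
      · exact mul_star_self_nonneg (g y)
      · exact mul_ne_zero hy (star_ne_zero.2 hy)
  obtain ⟨δ, hδ, hδK⟩ : ∃ δ : ℝ, 0 < δ ∧ ∀ y ∈ K, δ ≤ ‖s y‖ := by
    rcases K.eq_empty_or_nonempty with hKe | hKne
    · exact ⟨1, one_pos, by simp [hKe]⟩
    · obtain ⟨y₀, hy₀, hmin⟩ := hK.exists_isMinOn hKne (map_continuous s).norm.continuousOn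
      exact ⟨‖s y₀‖, norm_pos_iff.2 (hsK y₀ hy₀), fun y hy => hmin hy⟩
  -- `f s / (s + η)` lies in `J`, and it is close to `f` once `η ‖f‖ / δ` is small
  let η : ℝ := ε / 2 * δ / (‖f‖ + 1)
  have hη : 0 < η := by positivity
  have hden (y : X) : 0 < ‖s y‖ + η := by positivity
  let q : C₀(X, ℂ) :=
    { toFun := fun y => f y / ((‖s y‖ + η : ℝ) : ℂ)
      continuous_toFun := by
        refine (map_continuous f).div ?_ fun y => Complex.ofReal_ne_zero.2 (hden y).ne'
        exact Complex.continuous_ofReal.comp ((map_continuous s).norm.add continuous_const)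
      zero_at_infty' := by
        have h := (zero_at_infty f).norm.div_const η
        rw [norm_zero, zero_div] at h
        refine squeeze_zero_norm (fun y => ?_) h
        rw [norm_div, Complex.norm_real, Real.norm_of_nonneg (hden y).le]
        gcongr
        linarith [norm_nonneg (s y)] }
  refine ⟨s * q, hmul s hsJ q, ?_⟩
  rw [dist_eq_norm]
  refine lt_of_le_of_lt ?_ (half_lt_self hε)
  rw [← ZeroAtInftyContinuousMap.norm_toBCF_eq_norm,
    BoundedContinuousFunction.norm_le (half_pos hε).le]
  intro y
  change ‖f y - s y * (f y / ((‖s y‖ + η : ℝ) : ℂ))‖ ≤ ε / 2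
  have hsy : s y = ((‖s y‖ : ℝ) : ℂ) := (RCLike.norm_of_nonneg' (hs0 y)).symm
  have hne : ((‖s y‖ + η : ℝ) : ℂ) ≠ 0 := Complex.ofReal_ne_zero.2 (hden y).ne'
  have hval : f y - s y * (f y / ((‖s y‖ + η : ℝ) : ℂ)) =
      f y * ((η / (‖s y‖ + η) : ℝ) : ℂ) := by
    rw [Complex.ofReal_div]
    field_simp
    nth_rewrite 2 [hsy]
    push_cast
    ring
  rw [hval, norm_mul, Complex.norm_real, Real.norm_of_nonneg (by positivity)]
  by_cases hy : y ∈ K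
  · have h1 : ‖f y‖ ≤ ‖f‖ + 1 := (norm_apply_le_norm_zeroAtInfty f y).trans (by linarith)
    have h2 : η / (‖s y‖ + η) ≤ η / δ := by
      gcongr
      linarith [hδK y hy]
    calc ‖f y‖ * (η / (‖s y‖ + η)) ≤ (‖f‖ + 1) * (η / δ) := by gcongr
      _ = ε / 2 := by
        simp only [η]
        field_simp
  · have h1 : ‖f y‖ ≤ ε / 2 := (not_le.1 hy).le
    have h2 : η / (‖s y‖ + η) ≤ 1 := by
      rw [div_le_one (hden y)]
      linarith [norm_nonneg (s y)]
    calc ‖f y‖ * (η / (‖s y‖ + η)) ≤ ε / 2 * 1 := by gcongr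
      _ = ε / 2 := mul_one _

end ClosedIdeals

/-! ### Functions vanishing on the recurrent points give radical elements -/

section Radical

open Filter Topology

variable {X : Type*} [TopologicalSpace X] {φ : X → X} (hφ : IsProperMap φ)
  {H : Type*} [NormedAddCommGroup H] [InnerProductSpace ℂ H] [CompleteSpace H]
  (ρ : C₀(X, ℂ) →⋆ₙₐ[ℂ] (H →L[ℂ] H))

/-- The closed ideal of the functions `f` such that `U f` is in the radical. -/
def radicalIdeal : Set C₀(X, ℂ) :=
  {f | mono hφ ρ 1 f ∈ jacobsonRadical (crossedProduct hφ ρ)}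

theorem isClosed_radicalIdeal : IsClosed (radicalIdeal hφ ρ) :=
  (isClosed_jacobsonRadical (isClosed_crossedProduct hφ ρ)).preimage (continuous_mono hφ ρ 1)

theorem mul_mem_radicalIdeal {f : C₀(X, ℂ)} (hf : f ∈ radicalIdeal hφ ρ) (g : C₀(X, ℂ)) :
    f * g ∈ radicalIdeal hφ ρ := by
  have := mul_mem_jacobsonRadical_right (mono hφ ρ 0 g) hf
  rwa [mono_mul_mono, alpha_zero, add_zero] at this

/-- Semiprimeness of the radical, tested on monomials. -/
theorem mem_jacobsonRadical_of_forall_mul_mono_mul {T : crossedProduct hφ ρ}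
    (hT : ∀ k g, T * mono hφ ρ k g * T ∈ jacobsonRadical (crossedProduct hφ ρ)) :
    T ∈ jacobsonRadical (crossedProduct hφ ρ) := by
  refine mem_jacobsonRadical_of_forall_mul_mul fun b => ?_
  induction b using crossedProduct_induction with
  | hcl =>
    exact (isClosed_jacobsonRadical (isClosed_crossedProduct hφ ρ)).preimage
      ((continuous_const.mul continuous_id).mul continuous_const)
  | hadd b b' hb hb' =>
    rw [mul_add, add_mul]
    exact add_mem_jacobsonRadical hb hb'
  | hmono k g => exact hT k g

theorem mono_mem_jacobsonRadical_of_mem_radicalIdeal {f : C₀(X, ℂ)}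
    (hf : f ∈ radicalIdeal hφ ρ) {n : ℕ} (hn : 1 ≤ n) :
    mono hφ ρ n f ∈ jacobsonRadical (crossedProduct hφ ρ) := by
  obtain ⟨m, rfl⟩ := Nat.exists_eq_add_of_le' hn
  refine mem_jacobsonRadical_of_forall_mul_mono_mul hφ ρ fun k g => ?_
  -- the product has a factor `U f` on the right
  have h := mul_mem_jacobsonRadical_left
    (mono hφ ρ (m + 1 + k + m) (alpha hφ m (alpha hφ k f * g))) hf
  rw [mono_mul_mono, alpha_alpha, add_comm 1 m] at h
  rwa [mono_mul_mono, mono_mul_mono]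

theorem mem_radicalIdeal_of_vanishing {f : C₀(X, ℂ)}
    (hf : ∀ x, (∀ g ∈ radicalIdeal hφ ρ, g x = 0) → f x = 0) : f ∈ radicalIdeal hφ ρ := by
  refine mem_of_vanishing_on_zeros (isClosed_radicalIdeal hφ ρ) ?_ ?_
    (fun f hf g => mul_mem_radicalIdeal hφ ρ hf g) hf
  · change mono hφ ρ 1 0 ∈ jacobsonRadical (crossedProduct hφ ρ)
    rw [map_zero]
    exact zero_mem_jacobsonRadical
  · intro f hf g hg
    change mono hφ ρ 1 (f + g) ∈ jacobsonRadical (crossedProduct hφ ρ)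
    rw [map_add]
    exact add_mem_jacobsonRadical hf hg

variable [LocallyCompactSpace X]

/-- The system has no wandering sets on the zero set of `radicalIdeal`: if no point of this zero
set returned to `V`, then `U f` would be in the radical for each `f` that vanishes off `V`, since
the functions `α_{k+1}(f) f` in the coefficients of `U f A U f` vanish on the zero set. -/
theorem exists_iterate_mem_of_zeros_radicalIdeal [RegularSpace X] {V : Set X} (hV : IsOpen V)
    {p : X} (hp : ∀ g ∈ radicalIdeal hφ ρ, g p = 0) (hpV : p ∈ V) :
    ∃ y ∈ V, (∀ g ∈ radicalIdeal hφ ρ, g y = 0) ∧ ∃ n : ℕ, 1 ≤ n ∧ φ^[n] y ∈ V := by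
  by_contra! hwand
  obtain ⟨f, hfp, hfV, -⟩ := exists_zeroAtInfty_bump hV hpV
  refine one_ne_zero (hfp.symm.trans (hp f ?_))
  refine mem_jacobsonRadical_of_forall_mul_mono_mul hφ ρ fun k g => ?_
  rw [mono_mul_mono, mono_mul_mono]
  refine mono_mem_jacobsonRadical_of_mem_radicalIdeal hφ ρ
    (mem_radicalIdeal_of_vanishing hφ ρ fun y hy => ?_) (by omega)
  change f (φ^[k] (φ^[1] y)) * g (φ^[1] y) * f y = 0
  by_cases hyV : y ∈ V
  · have h := hwand y hyV hy (k + 1) (by omega)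
    rw [Function.iterate_add_apply] at h
    rw [hfV _ h, zero_mul, zero_mul]
  · rw [hfV y hyV, mul_zero]

/-- The recurrent points are dense in the zero set of `radicalIdeal`, by Baire's theorem. -/
theorem zeros_radicalIdeal_subset_closure_recurrentPoints [TopologicalSpace.MetrizableSpace X] :
    {x | ∀ g ∈ radicalIdeal hφ ρ, g x = 0} ⊆ closure (recurrentPoints φ) := by
  let := TopologicalSpace.metrizableSpaceMetric X
  set Y : Set X := {x | ∀ g ∈ radicalIdeal hφ ρ, g x = 0} with hYdef
  have hY : IsClosed Y := by
    have : Y = ⋂ g ∈ radicalIdeal hφ ρ, {x | g x = 0} := by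
      ext x
      simp [hYdef]
    rw [this]
    exact isClosed_biInter fun g _ => isClosed_eq (map_continuous g) continuous_const
  have := hY.locallyCompactSpace
  let D (k : ℕ) : Set Y := {y | ∃ n : ℕ, 1 ≤ n ∧ dist (φ^[n] y) (y : X) < 1 / (k + 1)}
  have hDo (k : ℕ) : IsOpen (D k) := by
    have : D k = ⋃ (n : ℕ) (_ : 1 ≤ n), {y : Y | dist (φ^[n] y) (y : X) < 1 / (k + 1)} := by
      ext y
      simp [D]
    rw [this]
    refine isOpen_iUnion fun n => isOpen_iUnion fun _ => isOpen_lt ?_ continuous_const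
    exact ((hφ.continuous.iterate n).comp continuous_subtype_val).dist continuous_subtype_val
  have hDd (k : ℕ) : Dense (D k) := by
    rw [Metric.dense_iff]
    intro p r hr
    let s := min r (1 / (2 * ((k : ℝ) + 1)))
    have hs : 0 < s := by positivity
    obtain ⟨y, hyV, hyY, n, hn, hny⟩ := exists_iterate_mem_of_zeros_radicalIdeal hφ ρ
      (Metric.isOpen_ball (x := (p : X)) (ε := s)) p.2 (Metric.mem_ball_self hs)
    refine ⟨⟨y, hyY⟩, Metric.ball_subset_ball (min_le_left _ _) hyV, n, hn, ?_⟩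
    have h1 : dist (φ^[n] y) p < 1 / (2 * ((k : ℝ) + 1)) :=
      lt_of_lt_of_le hny (min_le_right _ _)
    have h2 : dist y p < 1 / (2 * ((k : ℝ) + 1)) := lt_of_lt_of_le hyV (min_le_right _ _)
    calc dist (φ^[n] y) y ≤ dist (φ^[n] y) p + dist y p := dist_triangle_right _ _ _
      _ < 1 / (2 * ((k : ℝ) + 1)) + 1 / (2 * ((k : ℝ) + 1)) := add_lt_add h1 h2
      _ = 1 / ((k : ℝ) + 1) := by field_simp; norm_num
  have hdense := dense_iInter_of_isOpen_nat hDo hDd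
  intro x hx
  have hxc := hdense ⟨x, hx⟩
  rw [closure_subtype] at hxc
  refine closure_mono ?_ hxc
  rintro _ ⟨y, hy, rfl⟩ V hV
  obtain ⟨ε, hε, hεV⟩ := Metric.mem_nhds_iff.1 hV
  obtain ⟨k, hk⟩ := exists_nat_one_div_lt hε
  obtain ⟨n, hn, hd⟩ := Set.mem_iInter.1 hy k
  exact ⟨n, hn, hεV (hd.trans hk)⟩

theorem mono_mem_jacobsonRadical_of_vanishing [TopologicalSpace.MetrizableSpace X]
    {f : C₀(X, ℂ)} (hf : ∀ x ∈ recurrentPoints φ, f x = 0) {n : ℕ} (hn : 1 ≤ n) :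
    mono hφ ρ n f ∈ jacobsonRadical (crossedProduct hφ ρ) := by
  refine mono_mem_jacobsonRadical_of_mem_radicalIdeal hφ ρ
    (mem_radicalIdeal_of_vanishing hφ ρ fun x hx => ?_) hn
  have hcl : IsClosed {x | f x = 0} := isClosed_eq (map_continuous f) continuous_const
  exact closure_minimal hf hcl (zeros_radicalIdeal_subset_closure_recurrentPoints hφ ρ hx)

end Radical

end AnalyticCrossedProduct

theorem theorem0p1 {X : Type*} [TopologicalSpace X] [LocallyCompactSpace X]
    [TopologicalSpace.MetrizableSpace X]
    (φ : X → X) (hφ : IsProperMap φ) (hsurj : Function.Surjective φ)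
    {H : Type*} [NormedAddCommGroup H] [InnerProductSpace ℂ H] [CompleteSpace H]
    (ρ : C₀(X, ℂ) →⋆ₙₐ[ℂ] (H →L[ℂ] H)) (hρ : Function.Injective ρ) :
    AnalyticCrossedProduct.jacobsonRadical (AnalyticCrossedProduct.crossedProduct hφ ρ) =
      {T | AnalyticCrossedProduct.fourierCoeff hφ hρ 0 T = 0 ∧
        ∀ n : ℕ, 1 ≤ n → ∀ x ∈ AnalyticCrossedProduct.recurrentPoints φ,
          AnalyticCrossedProduct.fourierCoeff hφ hρ n T x = 0} := by
  open AnalyticCrossedProduct in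
  ext T
  constructor
  · intro hT
    exact ⟨fourierCoeff_zero_of_mem_jacobsonRadical hφ hρ hT, fun n _ x hx =>
      apply_eq_zero_of_mono_mem_jacobsonRadical hφ hρ
        (mono_fourierCoeff_mem_jacobsonRadical hφ hρ hT n) hx⟩
  · rintro ⟨h0, h⟩
    refine mem_jacobsonRadical_of_forall_mono_mem hφ hρ fun n => ?_
    rcases Nat.eq_zero_or_pos n with rfl | hn
    · rw [h0, map_zero]
      exact zero_mem_jacobsonRadical
    · exact mono_mem_jacobsonRadical_of_vanishing hφ ρ (h n hn) hn
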